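/- Let $G$ be a countable (simple, undirected, not necessarily connected) graph, regarded as a 1-complex in which each edge is a copy of $[0,1]$. For edge lengths $\ell : E(G)\to\mathbb R_{>0}$, let $d_\ell(x,y)$ be the infimum of the lengths of all arcs from $x$ to $y$ in $G$ (equivalently, of all finite concatenations of segments of edges leading from $x$ to $y$), where an edge $e$ has length $\ell(e)$, and $d_\ell(x,y)=\infty$ if there is no such arc. Let $|G|_\ell$ be the completion of the (extended) metric space obtained from $(G,d_\ell)$ by identifying points at distance $0$. A ray is a one-way infinite path; two rays are equivalent if no finite set of vertices separates them; the classes are the vertex-ends of $G$. For a finite $S\subseteq V(G)$ and a vertex-end $\omega$, let $C(S,\omega)$ be the component of $G-S$ that contains a ray of $\omega$. Let $\mathrm{MTOP}(G)$ be the set of all points of $G$ and all vertex-ends of $G$, with the topology generated by: the open sets of inner points of single edges; the open stars of radius $\varepsilon$, $0<\varepsilon<1$, around vertices; and, for all finite $S\subseteq V(G)$, all vertex-ends $\omega$ and all $\varepsilon>0$, the sets consisting of $C(S,\omega)$, all vertex-ends with a ray in $C(S,\omega)$, and all inner points of edges between $S$ and $C(S,\omega)$ at distance less than $\varepsilon$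 (in the edge as a copy of $[0,1]$) from their endvertex in $C(S,\omega)$. Write $|G|_\ell\approx \mathrm{MTOP}(G)$ if the identity on $G$ extends to a homeomorphism $|G|_\ell\to \mathrm{MTOP}(G)$. (1) Let $v_1,v_2,\dots$ be a (finite or infinite) enumeration of the vertices of $G$, let $\ell_i=\ell(v_i)>0$ be real numbers with $\sum_i \ell_i<\infty$, and let $\ell'(v_iv_j)=\tfrac12(\ell_i+\ell_j)$ for every edge $v_iv_j$ of $G$. Then $|G|_{\ell'}\approx \mathrm{MTOP}(G)$. (2) In particular, let $L(G)$ be the line graph of $G$, let $\ell:E(G)\to\mathbb R_{>0}$ satisfy $\sum_{e\in E(G)}\ell(e)<\infty$, and let $\ell_L(f)=\tfrac12(\ell(e)+\ell(d))$ for every edge $f$ of $L(G)$ joining $e,d\in E(G)$. Then $|L(G)|_{\ell_L}\approx \mathrm{MTOP}(L(G))$. -/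

import Mathlib

open scoped ENNReal

namespace GraphTop

universe u

variable {V : Type u}

/-! ### The graph as a 1-complex -/

/-- The underlying set of the 1-complex of a graph, in barycentric coordinates: its points are the
vertices `v`, and the points `(1 - t) u + t v` (`0 ≤ t ≤ 1`) of the edges `uv`. -/
def Point (G : SimpleGraph V) : Type u :=
  {x : V →₀ ℝ // (∃ v, x = Finsupp.single v 1) ∨
    ∃ u v, G.Adj u v ∧ ∃ t : unitInterval,
      x = Finsupp.single u (1 - (t : ℝ)) + Finsupp.single v (t : ℝ)}

/-- A vertex as a point of the 1-complex. -/
noncomputable def vtx (G : SimpleGraph V) (v : V) : Point G :=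
  ⟨Finsupp.single v 1, Or.inl ⟨v, rfl⟩⟩

/-- The point of the edge `uv` at distance `t` from `u`, the edge being a copy of `[0, 1]`. -/
noncomputable def edgePt {G : SimpleGraph V} {u v : V} (h : G.Adj u v) (t : unitInterval) :
    Point G :=
  ⟨Finsupp.single u (1 - (t : ℝ)) + Finsupp.single v (t : ℝ), Or.inr ⟨u, v, h, t, rfl⟩⟩

/-! ### The distance induced by edge lengths, and its completion -/

/-- `Route ℓ x y r`: there is a polygonal path of length `r` from `x` to `y`, i.e. a finite
concatenation of (straight) segments of edges, where the edge `e` is a copy of `[0, ℓ e]`. -/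
inductive Route {G : SimpleGraph V} (ℓ : G.edgeSet → ℝ) : Point G → Point G → ℝ → Prop
  | refl (x : Point G) : Route ℓ x x 0
  | cons {u v : V} (h : G.Adj u v) (s t : unitInterval) {y : Point G} {r : ℝ} :
      Route ℓ (edgePt h t) y r →
        Route ℓ (edgePt h s) y (ℓ ⟨s(u, v), h⟩ * |(s : ℝ) - (t : ℝ)| + r)

theorem Route.trans {G : SimpleGraph V} {ℓ : G.edgeSet → ℝ} {x y z : Point G} {r r' : ℝ}
    (h₁ : Route ℓ x y r) (h₂ : Route ℓ y z r') : Route ℓ x z (r + r') := by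
  induction h₁ with
  | refl x => simpa using h₂
  | cons h s t _ ih => rw [add_assoc]; exact .cons h s t (ih h₂)

theorem Route.symm {G : SimpleGraph V} {ℓ : G.edgeSet → ℝ} {x y : Point G} {r : ℝ}
    (h₁ : Route ℓ x y r) : Route ℓ y x r := by
  induction h₁ with
  | refl x => exact .refl x
  | cons h s t _ ih =>
    have := ih.trans (.cons h t s (.refl _))
    rwa [add_zero, add_comm, abs_sub_comm] at this

/-- The points of the 1-complex of `G`, with the distance induced by the edge lengths `ℓ`. -/
def LPoint {G : SimpleGraph V} (_ℓ : G.edgeSet → ℝ) : Type u := Point G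

/-- The distance `d_ℓ`: the infimum of the lengths of all polygonal paths from `x` to `y`
(equivalently, of all arcs from `x` to `y`: every arc of the 1-complex is polygonal, and every
polygonal path contains an arc with the same endpoints). It is `∞` for points in different
components, and it may vanish for distinct points. -/
noncomputable instance {G : SimpleGraph V} (ℓ : G.edgeSet → ℝ) : PseudoEMetricSpace (LPoint ℓ) where
  edist x y := ⨅ (r : ℝ) (_ : Route ℓ x y r), ENNReal.ofReal r
  edist_self x := by
    refine le_antisymm (iInf₂_le_of_le 0 (Route.refl x) (by simp)) zero_le
  edist_comm x y := le_antisymm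
    (le_iInf₂ fun r h => iInf₂_le_of_le r h.symm le_rfl)
    (le_iInf₂ fun r h => iInf₂_le_of_le r h.symm le_rfl)
  edist_triangle x y z := by
    simp only [ENNReal.iInf_add, ENNReal.add_iInf]
    refine le_iInf fun r => le_iInf fun h => le_iInf fun r' => le_iInf fun h' => ?_
    exact iInf₂_le_of_le (r' + r) (h'.trans h) ENNReal.ofReal_add_le

/-- The space `|G|_ℓ`: identify points at distance `0`, and take the completion. -/
abbrev LTop {G : SimpleGraph V} (ℓ : G.edgeSet → ℝ) : Type u :=
  UniformSpace.Completion (SeparationQuotient (LPoint ℓ))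

/-- The canonical map from the 1-complex `G` to `|G|_ℓ`. -/
noncomputable def toLTop {G : SimpleGraph V} (ℓ : G.edgeSet → ℝ) (x : Point G) : LTop ℓ :=
  ((SeparationQuotient.mk (X := LPoint ℓ) x : SeparationQuotient (LPoint ℓ)) : LTop ℓ)

/-! ### Vertex-ends -/

/-- A ray: a one-way infinite path. -/
structure Ray (G : SimpleGraph V) where
  toFun : ℕ → V
  injective : Function.Injective toFun
  adj : ∀ n, G.Adj (toFun n) (toFun (n + 1))

/-- `u` and `v` are joined by a path of `G - S`. -/
def Joined (G : SimpleGraph V) (S : Finset V) (u v : V) : Prop :=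
  ∃ p : G.Walk u v, ∀ x ∈ p.support, x ∉ S

/-- Two rays are vertex-equivalent if no finite set of vertices separates them. -/
def Ray.Equivalent {G : SimpleGraph V} (R L : Ray G) : Prop :=
  ∀ S : Finset V, ∃ i j, Joined G S (R.toFun i) (L.toFun j)

theorem Joined.symm {G : SimpleGraph V} {S : Finset V} {u v : V} (h : Joined G S u v) :
    Joined G S v u := by
  obtain ⟨p, hp⟩ := h
  exact ⟨p.reverse, by simpa using hp⟩

theorem Joined.trans {G : SimpleGraph V} {S : Finset V} {u v w : V} (h : Joined G S u v)
    (h' : Joined G S v w) : Joined G S u w := by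
  obtain ⟨p, hp⟩ := h
  obtain ⟨q, hq⟩ := h'
  refine ⟨p.append q, fun x hx => ?_⟩
  rcases (SimpleGraph.Walk.mem_support_append_iff p q).1 hx with hx | hx
  exacts [hp x hx, hq x hx]

theorem Joined.mono {G : SimpleGraph V} {S T : Finset V} {u v : V} (h : Joined G T u v)
    (hST : S ⊆ T) : Joined G S u v := by
  obtain ⟨p, hp⟩ := h
  exact ⟨p, fun x hx hS => hp x hx (hST hS)⟩

theorem Ray.exists_forall_notMem {G : SimpleGraph V} (R : Ray G) (S : Finset V) :
    ∃ n, ∀ i ≥ n, R.toFun i ∉ S := by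
  have hf : (R.toFun ⁻¹' (S : Set V)).Finite :=
    S.finite_toSet.preimage R.injective.injOn
  obtain ⟨n, hn⟩ := hf.bddAbove
  refine ⟨n + 1, fun i hi hS => ?_⟩
  have : i ≤ n := hn hS
  omega

theorem Ray.joined_tail {G : SimpleGraph V} (R : Ray G) {S : Finset V} {n : ℕ}
    (hn : ∀ i ≥ n, R.toFun i ∉ S) {i : ℕ} (hi : n ≤ i) :
    Joined G S (R.toFun n) (R.toFun i) := by
  induction i, hi using Nat.le_induction with
  | base => exact ⟨.nil, by simpa using hn n le_rfl⟩
  | succ i hi ih =>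
    refine ih.trans ⟨(R.adj i).toWalk, ?_⟩
    have h1 := hn i hi
    have h2 := hn (i + 1) (by omega)
    simp [h1, h2]

theorem Ray.Equivalent.trans {G : SimpleGraph V} {R L M : Ray G} (h : R.Equivalent L)
    (h' : L.Equivalent M) : R.Equivalent M := by
  classical
  intro S
  obtain ⟨n, hn⟩ := L.exists_forall_notMem S
  set T : Finset V := S ∪ (Finset.range n).image L.toFun with hT
  have hST : S ⊆ T := Finset.subset_union_left
  have key : ∀ j, L.toFun j ∉ T → n ≤ j := by
    intro j hj
    by_contra hlt
    exact hj (Finset.mem_union_right _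
      (Finset.mem_image_of_mem _ (Finset.mem_range.2 (not_le.1 hlt))))
  obtain ⟨i, j, hp⟩ := h T
  obtain ⟨j', k, hq⟩ := h' T
  have hj : n ≤ j := key j (by obtain ⟨p, hp⟩ := hp; exact hp _ p.end_mem_support)
  have hj' : n ≤ j' := key j' (by obtain ⟨q, hq⟩ := hq; exact hq _ q.start_mem_support)
  exact ⟨i, k, ((hp.mono hST).trans ((L.joined_tail hn hj).symm.trans
    (L.joined_tail hn hj'))).trans (hq.mono hST)⟩

/-- Vertex-equivalence of rays. -/
def raySetoid (G : SimpleGraph V) : Setoid (Ray G) where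
  r := Ray.Equivalent
  iseqv :=
    { refl := fun R S => by
        obtain ⟨n, hn⟩ := R.exists_forall_notMem S
        exact ⟨n, n, R.joined_tail hn le_rfl⟩
      symm := fun h S => by
        obtain ⟨i, j, hp⟩ := h S
        exact ⟨j, i, hp.symm⟩
      trans := Ray.Equivalent.trans }

/-- The set `Ω(G)` of vertex-ends of `G`. -/
def VertexEnd (G : SimpleGraph V) : Type u := Quotient (raySetoid G)

/-- `R` is an `ω`-ray. -/
def Ray.BelongsTo {G : SimpleGraph V} (R : Ray G) (ω : VertexEnd G) : Prop :=
  Quotient.mk (raySetoid G) R = ω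

/-! ### The topology `MTOP` -/

/-- The points of `MTOP(G)`: those of the 1-complex `G`, and the vertex-ends of `G`. -/
inductive MTop (G : SimpleGraph V) : Type u
  | point (x : Point G) : MTop G
  | vend (ω : VertexEnd G) : MTop G

/-- The set of vertices of `C(S, ω)`, the component of `G - S` that contains an `ω`-ray. -/
def compVerts (G : SimpleGraph V) (S : Finset V) (ω : VertexEnd G) : Set V :=
  {v | ∃ R : Ray G, R.BelongsTo ω ∧ (∀ n, R.toFun n ∉ S) ∧ Joined G S v (R.toFun 0)}

/-- The set of inner points of the edge `uv` whose distance from `u` lies in `U`. -/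
def edgeSub {G : SimpleGraph V} {u v : V} (h : G.Adj u v) (U : Set unitInterval) : Set (MTop G) :=
  {p | ∃ t ∈ U, 0 < t ∧ t < 1 ∧ p = .point (edgePt h t)}

/-- The open star of radius `ε` around the vertex `v`. -/
def openStar (G : SimpleGraph V) (v : V) (ε : ℝ) : Set (MTop G) :=
  {p | p = .point (vtx G v) ∨
    ∃ (w : V) (h : G.Adj v w) (t : unitInterval), (t : ℝ) < ε ∧ p = .point (edgePt h t)}

/-- The basic open set `Ĉ_ε(S, ω)`: the component `C = C(S, ω)` of `G - S` (its vertices and the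
points of its edges), the ends that have a ray in `C`, and the inner points of `S`-`C` edges at
distance less than `ε` from their endpoint in `C`. -/
def endNhd (G : SimpleGraph V) (S : Finset V) (ω : VertexEnd G) (ε : ℝ) : Set (MTop G) :=
  {p | (∃ v ∈ compVerts G S ω, p = .point (vtx G v)) ∨
    (∃ u ∈ compVerts G S ω, ∃ v ∈ compVerts G S ω, ∃ (h : G.Adj u v) (t : unitInterval),
      p = .point (edgePt h t)) ∨
    (∃ (ω' : VertexEnd G) (R : Ray G), R.BelongsTo ω' ∧ (∀ n, R.toFun n ∈ compVerts G S ω) ∧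
      p = .vend ω') ∨
    (∃ u ∈ compVerts G S ω, ∃ v ∈ S, ∃ (h : G.Adj u v) (t : unitInterval),
      0 < t ∧ t < 1 ∧ (t : ℝ) < ε ∧ p = .point (edgePt h t))}

/-- The topology of `MTOP(G)`, generated by the open sets of inner points of edges, the open stars
around vertices, and the sets `Ĉ_ε(S, ω)`. -/
instance (G : SimpleGraph V) : TopologicalSpace (MTop G) :=
  TopologicalSpace.generateFrom
    ({A | ∃ (u v : V) (h : G.Adj u v) (U : Set unitInterval), IsOpen U ∧ A = edgeSub h U} ∪
      {A | ∃ (v : V) (ε : ℝ), 0 < ε ∧ ε < 1 ∧ A = openStar G v ε} ∪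
      {A | ∃ (S : Finset V) (ω : VertexEnd G) (ε : ℝ), 0 < ε ∧ A = endNhd G S ω ε})

/-! ### The comparison -/

/-- `|G|_ℓ ≈ MTOP(G)`: the identity on `G` extends to a homeomorphism between these spaces. -/
def LTopApproxMTop {G : SimpleGraph V} (ℓ : G.edgeSet → ℝ) : Prop :=
  ∃ h : LTop ℓ ≃ₜ MTop G, ∀ x : Point G, h (toLTop ℓ x) = .point x

/-- The edge lengths `(w u + w v) / 2` of the edges `uv`, for a weight `w` on the vertices. -/
noncomputable def meanLength (G : SimpleGraph V) (w : V → ℝ) (e : G.edgeSet) : ℝ :=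
  Sym2.lift ⟨fun u v => (w u + w v) / 2, fun u v => by simp only [add_comm]⟩ (e : Sym2 V)

end GraphTop

namespace GraphTop

universe u

variable {V : Type u}

/-! ### Points and masses -/

/-! For a set `A` of vertices, the barycentric weight `mass G A` of a point varies only along edges
leaving `A`. An edge at `v` has length at least `w v / 2`. So if finitely many vertices meet all
edges leaving `A`, then `mass G A` is Lipschitz for the length distance (`isLip_mass`) and extends
continuously to `|G|_ℓ`. This covers single vertices and components `C` of `G - S` with `S` finite.
The generating open sets of `MTOP(G)` are given by strict inequalities between such weights, so they
are traces of open sets of the completion.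

Conversely, summability makes these sets small. Each edge of a path contributes half the weight of
each endpoint, so a path in `G - S` is no longer than the total weight outside `S`. If that total is
at most `r`, the points with weight near 1 in one component of `G - S` lie within `3 * r` of each
other (`IsComp.edist_le`). Stars and segments of edges are small because the weights are bounded.

Hence the vertices of a ray form a Cauchy sequence. Its limit has weight 1 in `C(S, ω)` for every
finite `S` (`exists_endPoint`), and the end `ω` is sent there. The resulting map `MTOP(G) → |G|_ℓ`
is injective because weights separate points and ends, and by the two observations above it is a
topological embedding.

For surjectivity, a limit with positive weight at some vertex lies on an edge or is a vertex
(`exists_point_of_massL_pos`). Any other limit has weight 1 in some component of `G - S` for each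
finite `S` (`exists_isComp_massL_eq_one`). As `S` exhausts the countable vertex set, these
components decrease to the empty set. They therefore determine a ray (`exists_ray_of_antitone`),
whose end is sent to the limit. -/

theorem Point.exists_rep {G : SimpleGraph V} (x : Point G) :
    ∃ (a b : V) (t : unitInterval), (a = b ∨ G.Adj a b) ∧
      x.1 = Finsupp.single a (1 - (t : ℝ)) + Finsupp.single b (t : ℝ) := by
  obtain ⟨x, ⟨v, rfl⟩ | ⟨u, v, h, t, rfl⟩⟩ := x
  · exact ⟨v, v, 0, Or.inl rfl, by simp⟩
  · exact ⟨u, v, t, Or.inr h, rfl⟩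

theorem edgePt_zero {G : SimpleGraph V} {u v : V} (h : G.Adj u v) :
    edgePt h 0 = vtx G u := Subtype.ext (by simp [edgePt, vtx])

theorem edgePt_one {G : SimpleGraph V} {u v : V} (h : G.Adj u v) :
    edgePt h 1 = vtx G v := Subtype.ext (by simp [edgePt, vtx])

theorem edgePt_symm {G : SimpleGraph V} {u v : V} (h : G.Adj u v) (t : unitInterval) :
    edgePt h.symm (unitInterval.symm t) = edgePt h t :=
  Subtype.ext (by simp [edgePt, add_comm])

/-- The total barycentric weight that the point `x` gives to the vertices in `A`. -/
noncomputable def mass (G : SimpleGraph V) (A : Set V) (x : Point G) : ℝ :=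
  Finsupp.linearCombination ℝ (A.indicator (1 : V → ℝ)) x.1

theorem mass_of_rep {G : SimpleGraph V} (A : Set V) {x : Point G} {a b : V} {s t : ℝ}
    (h : x.1 = Finsupp.single a s + Finsupp.single b t) :
    mass G A x = s * A.indicator 1 a + t * A.indicator 1 b := by
  simp [mass, h]

theorem mass_edgePt {G : SimpleGraph V} (A : Set V) {u v : V} (h : G.Adj u v) (t : unitInterval) :
    mass G A (edgePt h t) = (1 - (t : ℝ)) * A.indicator 1 u + t * A.indicator 1 v :=
  mass_of_rep A rfl

theorem mass_vtx {G : SimpleGraph V} (A : Set V) (v : V) :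
    mass G A (vtx G v) = A.indicator 1 v := by
  simp [mass, vtx]

theorem mass_nonneg {G : SimpleGraph V} (A : Set V) (x : Point G) : 0 ≤ mass G A x := by
  obtain ⟨a, b, t, -, h⟩ := x.exists_rep
  have h0 := t.2.1
  have h1 := t.2.2
  have h2 : (0 : ℝ) ≤ 1 - t := by linarith
  rw [mass_of_rep A h]
  by_cases ha : a ∈ A <;> by_cases hb : b ∈ A <;> simp [ha, hb, h0, h2]

theorem mass_singleton {G : SimpleGraph V} (v : V) (x : Point G) : mass G {v} x = x.1 v := by
  obtain ⟨a, b, t, -, h⟩ := x.exists_rep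
  classical
  rw [mass_of_rep _ h, h, Finsupp.add_apply]
  simp only [Finsupp.single_apply, Set.indicator_apply, Set.mem_singleton_iff, mul_ite, mul_zero,
    Pi.one_apply, mul_one]

theorem point_ext_of_mass {G : SimpleGraph V} {x y : Point G}
    (h : ∀ v, mass G {v} x = mass G {v} y) : x = y :=
  Subtype.ext (Finsupp.ext fun v => by simpa only [mass_singleton] using h v)

theorem exists_mass_singleton_pos {G : SimpleGraph V} (x : Point G) : ∃ v, 0 < mass G {v} x := by
  obtain ⟨a, b, t, -, h⟩ := x.exists_rep
  have h0 := t.2.1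
  have h1 := t.2.2
  simp only [mass_singleton, h, Finsupp.add_apply]
  rcases h0.lt_or_eq with ht | ht
  · refine ⟨b, ?_⟩
    have : 0 ≤ Finsupp.single a (1 - (t : ℝ)) b := by
      classical
      rw [Finsupp.single_apply]
      split_ifs <;> linarith
    rw [Finsupp.single_eq_same]
    linarith
  · exact ⟨a, by simp [← ht]⟩

theorem mass_coe_finset {G : SimpleGraph V} (S : Finset V) (x : Point G) :
    mass G S x = ∑ v ∈ S, mass G {v} x := by
  classical
  obtain ⟨a, b, t, -, h⟩ := x.exists_rep
  simp only [mass_of_rep _ h, Finset.sum_add_distrib, ← Finset.mul_sum]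
  simp [Set.indicator_apply]

/-- Points with positive weight at both ends of an edge lie on that edge. -/
theorem eq_edgePt_of_pos {G : SimpleGraph V} {u v : V} (huv : u ≠ v) {x : Point G}
    (hu : 0 < mass G {u} x) (hv : 0 < mass G {v} x) :
    ∃ (h : G.Adj u v) (t : unitInterval), 0 < t ∧ t < 1 ∧ x = edgePt h t := by
  obtain ⟨a, b, t, hab, h⟩ := x.exists_rep
  rw [mass_of_rep _ h] at hu hv
  have hx : (a = u ∧ b = v) ∨ (a = v ∧ b = u) := by
    by_cases h1 : a = u <;> by_cases h2 : b = v <;> by_cases h3 : a = v <;>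
      by_cases h4 : b = u <;> simp_all
  rcases hx with ⟨rfl, rfl⟩ | ⟨rfl, rfl⟩
  · refine ⟨hab.resolve_left huv, t, ?_, ?_, Subtype.ext h⟩
    · simpa [huv, huv.symm] using hv
    · simpa [huv, huv.symm] using hu
  · refine ⟨(hab.resolve_left huv.symm).symm, unitInterval.symm t, ?_, ?_, ?_⟩
    · rw [← Subtype.coe_lt_coe]
      simpa [huv, huv.symm] using hv
    · rw [← Subtype.coe_lt_coe]
      simpa [huv, huv.symm] using hu
    · exact Subtype.ext h |>.trans (edgePt_symm (hab.resolve_left huv.symm) t).symm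

/-! ### Lipschitz functions on the 1-complex -/

/-- A form of Lipschitz continuity that says nothing about points at infinite distance. -/
def IsLip {α : Type*} [PseudoEMetricSpace α] (K : ℝ) (f : α → ℝ) : Prop :=
  0 ≤ K ∧ ∀ x y δ, edist x y < ENNReal.ofReal δ → |f x - f y| ≤ K * δ

/-- The distance `d_ℓ`, as a function on the points of the 1-complex. -/
noncomputable def lengthEDist {G : SimpleGraph V} (ℓ : G.edgeSet → ℝ) (x y : Point G) : ℝ≥0∞ :=
  edist (α := LPoint ℓ) x y

section LengthEDist

variable {G : SimpleGraph V} (ℓ : G.edgeSet → ℝ)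

theorem lengthEDist_self (x : Point G) : lengthEDist ℓ x x = 0 :=
  edist_self (α := LPoint ℓ) x

theorem lengthEDist_comm (x y : Point G) : lengthEDist ℓ x y = lengthEDist ℓ y x :=
  edist_comm (α := LPoint ℓ) x y

theorem lengthEDist_triangle (x y z : Point G) :
    lengthEDist ℓ x z ≤ lengthEDist ℓ x y + lengthEDist ℓ y z :=
  edist_triangle (α := LPoint ℓ) x y z

theorem lengthEDist_le_of_route {ℓ : G.edgeSet → ℝ} {x y : Point G} {r : ℝ}
    (h : Route ℓ x y r) : lengthEDist ℓ x y ≤ ENNReal.ofReal r :=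
  iInf₂_le r h

end LengthEDist

theorem Route.abs_sub_le {G : SimpleGraph V} {ℓ : G.edgeSet → ℝ} {K : ℝ} {f : Point G → ℝ}
    (hf : ∀ u v (h : G.Adj u v) (s t : unitInterval),
      |f (edgePt h s) - f (edgePt h t)| ≤ K * (ℓ ⟨s(u, v), h⟩ * |(s : ℝ) - t|))
    {x y : Point G} {r : ℝ} (h : Route ℓ x y r) : |f x - f y| ≤ K * r := by
  induction h with
  | refl x => simp
  | @cons u v h s t y r _ ih =>
    have := hf u v h s t
    have h2 := _root_.abs_sub_le (f (edgePt h s)) (f (edgePt h t)) (f y)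
    rw [mul_add]
    linarith

/-- The distance is an infimum over routes, and a bound on single segments adds up along a route. -/
theorem isLip_of_edge {G : SimpleGraph V} {ℓ : G.edgeSet → ℝ} {K : ℝ} (hK : 0 ≤ K)
    {f : Point G → ℝ}
    (hf : ∀ u v (h : G.Adj u v) (s t : unitInterval),
      |f (edgePt h s) - f (edgePt h t)| ≤ K * (ℓ ⟨s(u, v), h⟩ * |(s : ℝ) - t|)) :
    IsLip (α := LPoint ℓ) K f := by
  refine ⟨hK, fun x y δ h => ?_⟩
  obtain ⟨r, hr⟩ := iInf_lt_iff.1 h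
  obtain ⟨hr, hlt⟩ := iInf_lt_iff.1 hr
  have : r < δ := by
    by_contra hc
    exact absurd hlt (not_lt.2 (ENNReal.ofReal_le_ofReal (not_lt.1 hc)))
  exact (hr.abs_sub_le hf).trans (mul_le_mul_of_nonneg_left this.le hK)

theorem meanLength_mk {G : SimpleGraph V} (w : V → ℝ) {u v : V} (h : G.Adj u v) :
    meanLength G w ⟨s(u, v), h⟩ = (w u + w v) / 2 := rfl

/-- A Lipschitz constant for the weight of sets whose edge boundary is covered by `S`. -/
noncomputable def lipConst (w : V → ℝ) (S : Finset V) : ℝ := ∑ v ∈ S, 2 / w v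

theorem lipConst_nonneg {w : V → ℝ} (hw : ∀ v, 0 < w v) (S : Finset V) : 0 ≤ lipConst w S :=
  Finset.sum_nonneg fun v _ => (div_pos two_pos (hw v)).le

/-- An edge at `a` has length at least `w a / 2`, and `2 / w a` is one summand of the constant. This
lower bound, uniform over all edges at `a`, is what averaging vertex weights provides. -/
theorem one_le_lipConst_mul {G : SimpleGraph V} {w : V → ℝ} (hw : ∀ v, 0 < w v) {S : Finset V}
    {u v : V} (h : G.Adj u v) (hS : u ∈ S ∨ v ∈ S) :
    1 ≤ lipConst w S * meanLength G w ⟨s(u, v), h⟩ := by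
  rw [meanLength_mk]
  have key : ∀ a b : V, a ∈ S → 1 ≤ lipConst w S * ((w a + w b) / 2) := by
    intro a b ha
    have h1 : 2 / w a ≤ lipConst w S :=
      Finset.single_le_sum (f := fun v => 2 / w v)
        (fun v _ => (div_pos two_pos (hw v)).le) ha
    have ha' := hw a
    have hb' := hw b
    have h0 := lipConst_nonneg hw S
    calc 1 = 2 / w a * (w a / 2) := by field_simp
      _ ≤ lipConst w S * ((w a + w b) / 2) := by gcongr; linarith
  rcases hS with h | h
  · exact key u v h
  · rw [add_comm]; exact key v u h

/-- The weight is constant on edges inside or outside `A`. On an edge leaving `A` it changes at unit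
rate in the parameter, and such an edge meets `S`, so it is not too short. -/
theorem isLip_mass {G : SimpleGraph V} {w : V → ℝ} (hw : ∀ v, 0 < w v) {A : Set V} {S : Finset V}
    (hA : ∀ u v, G.Adj u v → u ∈ A → v ∉ A → u ∈ S ∨ v ∈ S) :
    IsLip (α := LPoint (meanLength G w)) (lipConst w S) (mass G A) := by
  refine isLip_of_edge (lipConst_nonneg hw S) fun u v h s t => ?_
  rw [mass_edgePt, mass_edgePt]
  have key : (u ∈ S ∨ v ∈ S) → |(s : ℝ) - t| ≤
      lipConst w S * (meanLength G w ⟨s(u, v), h⟩ * |(s : ℝ) - t|) := by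
    intro hS
    rw [← mul_assoc]
    exact le_mul_of_one_le_left (abs_nonneg _) (one_le_lipConst_mul hw h hS)
  have hnn : 0 ≤ lipConst w S * (meanLength G w ⟨s(u, v), h⟩ * |(s : ℝ) - t|) := by
    rw [meanLength_mk]
    have := hw u
    have := hw v
    have := lipConst_nonneg hw S
    positivity
  by_cases hu : u ∈ A <;> by_cases hv : v ∈ A
  · simpa [hu, hv] using hnn
  · have := key (hA u v h hu hv)
    simpa [hu, hv, abs_sub_comm] using this
  · have := key (hA v u h.symm hv hu).symm
    simpa [hu, hv] using this
  · simpa [hu, hv] using hnn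

theorem isLip_mass_singleton {G : SimpleGraph V} {w : V → ℝ} (hw : ∀ v, 0 < w v) (v : V) :
    IsLip (α := LPoint (meanLength G w)) (lipConst w {v}) (mass G {v}) :=
  isLip_mass hw fun a b _ ha _ => Or.inl (by simpa using ha)

theorem isLip_mass_finset {G : SimpleGraph V} {w : V → ℝ} (hw : ∀ v, 0 < w v) (S : Finset V) :
    IsLip (α := LPoint (meanLength G w)) (lipConst w S) (mass G S) :=
  isLip_mass hw fun a b _ ha _ => Or.inl (by simpa using ha)

/-- The tent function on the edge `uv`; it vanishes off this edge. -/
noncomputable def tent (G : SimpleGraph V) (u v : V) (x : Point G) : ℝ :=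
  min (mass G {u} x) (mass G {v} x)

theorem isLip_tent {G : SimpleGraph V} {w : V → ℝ} (hw : ∀ v, 0 < w v) {u v : V} (huv : u ≠ v) :
    IsLip (α := LPoint (meanLength G w)) (lipConst w {u}) (tent G u v) := by
  refine isLip_of_edge (lipConst_nonneg hw _) fun a b h s t => ?_
  have hnn : 0 ≤ lipConst w {u} * (meanLength G w ⟨s(a, b), h⟩ * |(s : ℝ) - t|) := by
    rw [meanLength_mk]
    have := hw a
    have := hw b
    have := lipConst_nonneg hw {u}
    positivity
  by_cases hx : (a = u ∧ b = v) ∨ (a = v ∧ b = u)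
  · have key : |(s : ℝ) - t| ≤
        lipConst w {u} * (meanLength G w ⟨s(a, b), h⟩ * |(s : ℝ) - t|) := by
      rw [← mul_assoc]
      exact le_mul_of_one_le_left (abs_nonneg _) (one_le_lipConst_mul hw h
        (by rcases hx with ⟨h, -⟩ | ⟨-, h⟩ <;> simp [h]))
    refine le_trans ?_ key
    -- The two inequalities serve the two orientations of the edge.
    have h1 := abs_min_sub_min_le_max (1 - (s : ℝ)) s (1 - t) t
    have h2 := abs_min_sub_min_le_max (s : ℝ) (1 - s) t (1 - t)
    have h3 : |1 - (s : ℝ) - (1 - t)| = |(s : ℝ) - t| := by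
      rw [abs_sub_comm (s : ℝ)]; congr 1; ring
    rw [h3, max_self] at h1 h2
    rcases hx with ⟨rfl, rfl⟩ | ⟨rfl, rfl⟩
    · simpa [tent, mass_edgePt, huv, huv.symm] using h1
    · simpa [tent, mass_edgePt, huv, huv.symm] using h2
  · have h0 : ∀ r : unitInterval, tent G u v (edgePt h r) = 0 := by
      intro r
      refine le_antisymm ?_ (le_min (mass_nonneg _ _) (mass_nonneg _ _))
      rw [tent, min_le_iff, mass_edgePt, mass_edgePt]
      have hab := h.ne
      by_cases h1 : a = u <;> by_cases h2 : b = v <;> by_cases h3 : a = v <;>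
        by_cases h4 : b = u <;> simp_all
    rw [h0, h0]
    simpa using hnn

/-! ### Extension to a completion -/

section Extension

open Topology Filter Uniformity

/-- An open set is contained in each closed set that contains its points from a dense range. -/
theorem subset_of_denseRange {α β : Type*} [TopologicalSpace β] {i : α → β} (hd : DenseRange i) {O F : Set β} (hO : IsOpen O) (hF : IsClosed F)
    (h : ∀ x, i x ∈ O → i x ∈ F) : O ⊆ F := by
  refine (hd.open_subset_closure_inter hO).trans (closure_minimal ?_ hF)
  rintro _ ⟨hz, x, rfl⟩
  exact h x hz

variable {α β : Type*} [PseudoEMetricSpace α] [UniformSpace β] {i : α → β}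

theorem IsLip.uniformContinuous {K : ℝ} {f : α → ℝ} (hf : IsLip K f) : UniformContinuous f := by
  rw [EMetric.uniformContinuous_iff]
  intro ε hε
  obtain ⟨r, hr0, hr⟩ : ∃ r : ℝ, 0 < r ∧ ENNReal.ofReal r ≤ ε := by
    rcases eq_or_ne ε ⊤ with rfl | h
    · exact ⟨1, one_pos, le_top⟩
    · exact ⟨ε.toReal, ENNReal.toReal_pos hε.ne' h, (ENNReal.ofReal_toReal h).le⟩
  -- Dividing by `K + 1` instead of `K` allows `K = 0`.
  have hK : 0 < K + 1 := by linarith [hf.1]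
  refine ⟨ENNReal.ofReal (r / (K + 1)), by simpa using div_pos hr0 hK, fun {a b} h => ?_⟩
  have h1 := hf.2 a b _ h
  rw [edist_dist, Real.dist_eq]
  refine lt_of_lt_of_le ((ENNReal.ofReal_lt_ofReal_iff hr0).2 (h1.trans_lt ?_)) hr
  rw [mul_div_assoc', div_lt_iff₀ hK]
  nlinarith

/-- The continuous extension of `f` along `i`. -/
noncomputable def extendAlong (hi : IsUniformInducing i) (hd : DenseRange i) (f : α → ℝ) : β → ℝ :=
  (hi.isDenseInducing hd).extend f

theorem continuous_extendAlong (hi : IsUniformInducing i) (hd : DenseRange i) {K : ℝ} {f : α → ℝ}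
    (hf : IsLip K f) : Continuous (extendAlong hi hd f) :=
  (uniformContinuous_uniformly_extend hi hd hf.uniformContinuous).continuous

theorem extendAlong_apply (hi : IsUniformInducing i) (hd : DenseRange i) {K : ℝ} {f : α → ℝ}
    (hf : IsLip K f) (x : α) : extendAlong hi hd f (i x) = f x :=
  uniformly_extend_of_ind hi hd hf.uniformContinuous x

/-- Near a point of the completion there are points of the dense subspace at which all Lipschitz
functions take almost the same value. -/
theorem exists_near (hi : IsUniformInducing i) (hd : DenseRange i) {O : Set β} (hO : IsOpen O)
    {z : β} (hz : z ∈ O) {δ : ℝ} (hδ : 0 < δ) :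
    ∃ x, i x ∈ O ∧ ∀ (K : ℝ) (f : α → ℝ), IsLip K f →
      |extendAlong hi hd f z - f x| ≤ K * δ := by
  have hU : {p : α × α | edist p.1 p.2 < ENNReal.ofReal δ} ∈ 𝓤 α :=
    edist_mem_uniformity (by simpa using hδ)
  rw [← hi.comap_uniformity, mem_comap] at hU
  obtain ⟨W, hW, hWU⟩ := hU
  obtain ⟨T, hT, hTs, hTW⟩ := comp_symm_mem_uniformity_sets hW
  obtain ⟨O', hO'T, hO', hzO'⟩ := mem_nhds_iff.1 (UniformSpace.ball_mem_nhds z hT)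
  obtain ⟨_, ⟨hx1, hx2⟩, x, rfl⟩ := hd.inter_open_nonempty (O ∩ O') (hO.inter hO') ⟨z, hz, hzO'⟩
  refine ⟨x, hx1, fun K f hf => ?_⟩
  -- The choice of `x` precedes `f`. Every `i y` in `O'` is close to `i x` via `z`, so the Lipschitz
  -- bound holds on a dense part of `O'`, and being a closed condition it holds at `z`.
  refine subset_of_denseRange (F := {z | |extendAlong hi hd f z - f x| ≤ K * δ}) hd hO'
    (isClosed_le (((continuous_extendAlong hi hd hf).sub continuous_const).abs)
      continuous_const) (fun y hy => ?_) hzO'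
  simp only [Set.mem_ofPred_eq]
  rw [extendAlong_apply hi hd hf]
  refine hf.2 y x δ (@hWU (y, x) (?_ : (i y, i x) ∈ W))
  refine hTW ⟨z, ?_, hO'T hx2⟩
  exact SetRel.symm T (hO'T hy)

/-- Open sets whose trace on the dense subspace is small are small. -/
theorem exists_small (hi : IsUniformInducing i) (hd : DenseRange i) {W : Set (β × β)}
    (hW : W ∈ 𝓤 β) : ∃ r : ℝ, 0 < r ∧ ∀ O : Set β, IsOpen O →
      (∀ x y, i x ∈ O → i y ∈ O → edist x y ≤ ENNReal.ofReal r) →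
      ∀ z ∈ O, ∀ z' ∈ O, (z, z') ∈ W := by
  -- Closedness of `T` lets membership pass from the dense image to all of `O ×ˢ O`.
  obtain ⟨T, ⟨hT, hTc⟩, hTW⟩ := uniformity_hasBasis_closed.mem_iff.1 hW
  have hU : (fun p : α × α => (i p.1, i p.2)) ⁻¹' T ∈ 𝓤 α := by
    rw [← hi.comap_uniformity]
    exact preimage_mem_comap hT
  obtain ⟨ε, hε, h⟩ := mem_uniformity_edist.1 hU
  obtain ⟨r, hr0, hr⟩ := ENNReal.lt_iff_exists_nnreal_btwn.1 hε
  refine ⟨r, by simpa using hr0, fun O hO hs z hz z' hz' => hTW ?_⟩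
  have hd2 : DenseRange (Prod.map i i) := hd.prodMap hd
  refine subset_of_denseRange hd2 (hO.prod hO) hTc (fun p hp => ?_) (⟨hz, hz'⟩ : (z, z') ∈ O ×ˢ O)
  exact @h p.1 p.2 (lt_of_le_of_lt (hs _ _ hp.1 hp.2) (by simpa using hr))

theorem eq_of_forall_small [T0Space β] (hi : IsUniformInducing i) (hd : DenseRange i) {z z' : β}
    (h : ∀ r : ℝ, 0 < r → ∃ O : Set β, IsOpen O ∧ z ∈ O ∧ z' ∈ O ∧
      ∀ x y, i x ∈ O → i y ∈ O → edist x y ≤ ENNReal.ofReal r) : z = z' := by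
  refine eq_of_uniformity fun {W} hW => ?_
  obtain ⟨r, hr, hs⟩ := exists_small hi hd hW
  obtain ⟨O, hO, hz, hz', hxy⟩ := h r hr
  exact hs O hO hxy z hz z' hz'

end Extension

/-! ### Components of `G - S` -/

/-- `C` is empty or the vertex set of a component of `G - S`. -/
def IsComp (G : SimpleGraph V) (S : Finset V) (C : Set V) : Prop :=
  ∀ u ∈ C, ∀ v, v ∈ C ↔ Joined G S u v

section Components

variable {G : SimpleGraph V} {S T : Finset V} {C D : Set V}

/-- For `u ∈ S` the set is empty, which `IsComp` permits. -/
theorem isComp_setOf_joined (G : SimpleGraph V) (S : Finset V) (u : V) :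
    IsComp G S {v | Joined G S u v} :=
  fun _ ha _ => ⟨fun hb => ha.symm.trans hb, fun hb => Joined.trans ha hb⟩

theorem joined_self {v : V} (h : v ∉ S) : Joined G S v v := ⟨.nil, by simpa using h⟩

theorem joined_of_adj {u v : V} (h : G.Adj u v) (hu : u ∉ S) (hv : v ∉ S) : Joined G S u v :=
  ⟨h.toWalk, by simp [hu, hv]⟩

theorem Joined.left_notMem {u v : V} (h : Joined G S u v) : u ∉ S := by
  obtain ⟨p, hp⟩ := h
  exact hp _ p.start_mem_support

theorem IsComp.notMem (hC : IsComp G S C) {u : V} (hu : u ∈ C) : u ∉ S :=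
  ((hC u hu u).1 hu).left_notMem

theorem IsComp.mem_of_adj (hC : IsComp G S C) {u v : V} (hu : u ∈ C) (h : G.Adj u v)
    (hv : v ∉ S) : v ∈ C :=
  (hC u hu v).2 (joined_of_adj h (hC.notMem hu) hv)

theorem IsComp.subset (hC : IsComp G S C) (hD : IsComp G T D) (hST : S ⊆ T) {u : V} (hu : u ∈ C)
    (hu' : u ∈ D) : D ⊆ C :=
  fun v hv => (hC u hu v).2 (((hD u hu' v).1 hv).mono hST)

theorem IsComp.eq (hC : IsComp G S C) (hD : IsComp G S D) {u : V} (hu : u ∈ C)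
    (hu' : u ∈ D) : C = D :=
  (hD.subset hC (Finset.Subset.refl S) hu' hu).antisymm
    (hC.subset hD (Finset.Subset.refl S) hu hu')

theorem IsComp.boundary (hC : IsComp G S C) {u v : V} (h : G.Adj u v) (hu : u ∈ C) (hv : v ∉ C) :
    u ∈ S ∨ v ∈ S := by
  by_contra hc
  exact hv (hC.mem_of_adj hu h fun h => hc (Or.inr h))

end Components

/-! ### Ends and components -/

/-- The ray obtained by deleting the first `n` vertices. -/
def Ray.drop {G : SimpleGraph V} (R : Ray G) (n : ℕ) : Ray G where
  toFun i := R.toFun (n + i)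
  injective _ _ h := by simpa using R.injective h
  adj i := R.adj (n + i)

theorem Ray.belongsTo_mk {G : SimpleGraph V} (R : Ray G) :
    R.BelongsTo (Quotient.mk (raySetoid G) R) := rfl

theorem VertexEnd.exists_ray {G : SimpleGraph V} (ω : VertexEnd G) : ∃ R : Ray G, R.BelongsTo ω :=
  Quotient.exists_rep ω

theorem Ray.BelongsTo.equivalent {G : SimpleGraph V} {R L : Ray G} {ω : VertexEnd G}
    (hR : R.BelongsTo ω) (hL : L.BelongsTo ω) : R.Equivalent L :=
  Quotient.exact (s := raySetoid G) (hR.trans hL.symm)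

theorem Ray.BelongsTo.of_equivalent {G : SimpleGraph V} {R L : Ray G} {ω : VertexEnd G}
    (hR : R.BelongsTo ω) (h : L.Equivalent R) : L.BelongsTo ω :=
  (Quotient.sound (s := raySetoid G) h).trans hR

theorem Ray.drop_equivalent {G : SimpleGraph V} (R : Ray G) (n : ℕ) :
    (R.drop n).Equivalent R := by
  intro S
  obtain ⟨m, hm⟩ := R.exists_forall_notMem S
  exact ⟨m, n + m, joined_self (hm _ (by omega))⟩

theorem Ray.Equivalent.joined {G : SimpleGraph V} {R L : Ray G} (h : R.Equivalent L)
    {S : Finset V} {m n : ℕ} (hm : ∀ i ≥ m, R.toFun i ∉ S) (hn : ∀ i ≥ n, L.toFun i ∉ S) :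
    Joined G S (R.toFun m) (L.toFun n) := by
  have h' : (R.drop m).Equivalent (L.drop n) :=
    ((R.drop_equivalent m).trans h).trans
      ((raySetoid G).iseqv.symm (L.drop_equivalent n))
  obtain ⟨i, j, hij⟩ := h' S
  exact ((R.joined_tail hm (Nat.le_add_right m i)).trans hij).trans
    (L.joined_tail hn (Nat.le_add_right n j)).symm

/-- Tails of equivalent rays that avoid `S` lie in the same component of `G - S`, so a single ray of
the end determines the component. -/
theorem compVerts_eq {G : SimpleGraph V} {R : Ray G} {ω : VertexEnd G} (hR : R.BelongsTo ω)
    {S : Finset V} {n : ℕ} (hn : ∀ i ≥ n, R.toFun i ∉ S) :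
    compVerts G S ω = {v | Joined G S (R.toFun n) v} := by
  ext v
  constructor
  · rintro ⟨L, hL, hLS, hv⟩
    exact ((hR.equivalent hL).joined hn fun i _ => hLS i).trans hv.symm
  · intro hv
    exact ⟨R.drop n, hR.of_equivalent (R.drop_equivalent n), fun i => hn _ (by omega),
      Joined.symm hv⟩

theorem isComp_compVerts (G : SimpleGraph V) (S : Finset V) (ω : VertexEnd G) :
    IsComp G S (compVerts G S ω) := by
  obtain ⟨R, hR⟩ := ω.exists_ray
  obtain ⟨n, hn⟩ := R.exists_forall_notMem S
  rw [compVerts_eq hR hn]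
  exact isComp_setOf_joined _ _ _

theorem Ray.BelongsTo.exists_forall_mem {G : SimpleGraph V} {R : Ray G} {ω : VertexEnd G}
    (hR : R.BelongsTo ω) (S : Finset V) : ∃ n, ∀ i ≥ n, R.toFun i ∈ compVerts G S ω := by
  obtain ⟨n, hn⟩ := R.exists_forall_notMem S
  rw [compVerts_eq hR hn]
  exact ⟨n, fun i hi => R.joined_tail hn hi⟩

/-- If rays of the two ends have tails in a common component for every `S`, no finite set separates
them. -/
theorem VertexEnd.ext_compVerts {G : SimpleGraph V} {ω ω' : VertexEnd G}
    (h : ∀ S, compVerts G S ω = compVerts G S ω') : ω = ω' := by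
  obtain ⟨R, rfl⟩ := ω.exists_ray
  obtain ⟨L, rfl⟩ := ω'.exists_ray
  refine Quotient.sound (s := raySetoid G) fun S => ?_
  obtain ⟨m, hm⟩ := R.belongsTo_mk.exists_forall_mem S
  obtain ⟨n, hn⟩ := L.belongsTo_mk.exists_forall_mem S
  rw [← h S] at hn
  exact ⟨m, n, (isComp_compVerts G S _ _ (hm m le_rfl) _).1 (hn n le_rfl)⟩

theorem exists_ray_in_compVerts_iff {G : SimpleGraph V} {S : Finset V} {ω ω' : VertexEnd G} :
    (∃ R : Ray G, R.BelongsTo ω' ∧ ∀ n, R.toFun n ∈ compVerts G S ω) ↔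
      compVerts G S ω' = compVerts G S ω := by
  constructor
  · rintro ⟨R, hR, h⟩
    obtain ⟨n, hn⟩ := hR.exists_forall_mem S
    exact (isComp_compVerts G S ω').eq (isComp_compVerts G S ω) (hn n le_rfl) (h n)
  · intro h
    obtain ⟨R, hR⟩ := ω'.exists_ray
    obtain ⟨n, hn⟩ := hR.exists_forall_mem S
    exact ⟨R.drop n, hR.of_equivalent (R.drop_equivalent n), fun i => h ▸ hn _ (by omega)⟩

/-! ### Masses of disjoint sets -/

theorem mass_add_le_one {G : SimpleGraph V} {A B : Set V} (h : Disjoint A B) (x : Point G) :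
    mass G A x + mass G B x ≤ 1 := by
  obtain ⟨a, b, t, -, hx⟩ := x.exists_rep
  have h0 := t.2.1
  have h1 := t.2.2
  rw [mass_of_rep _ hx, mass_of_rep _ hx]
  have ha : a ∈ A → a ∉ B := fun h1 => Set.disjoint_left.1 h h1
  have hb : b ∈ A → b ∉ B := fun h1 => Set.disjoint_left.1 h h1
  by_cases h2 : a ∈ A <;> by_cases h3 : b ∈ A <;> by_cases h4 : a ∈ B <;> by_cases h5 : b ∈ B <;>
    simp_all

theorem exists_mem_of_mass_pos {G : SimpleGraph V} {A : Set V} {x : Point G}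
    (h : 0 < mass G A x) : ∃ a ∈ A, 0 < mass G {a} x := by
  obtain ⟨a, b, t, -, hx⟩ := x.exists_rep
  have h0 := t.2.1
  have h1 := t.2.2
  rw [mass_of_rep _ hx] at h
  rcases h0.lt_or_eq with ht | ht
  · rcases h1.lt_or_eq with ht' | ht'
    · have hab : a ∈ A ∨ b ∈ A := by
        by_contra hc
        simp_all
      rcases hab with ha | hb
      · refine ⟨a, ha, ?_⟩
        rw [mass_of_rep _ hx]
        by_cases hba : b = a <;> simp [hba]
        exact ht'
      · refine ⟨b, hb, ?_⟩
        rw [mass_of_rep _ hx]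
        by_cases hba : a = b <;> simp [hba]
        exact ht
    · have hb : b ∈ A := by
        by_contra hc
        simp_all
      refine ⟨b, hb, ?_⟩
      rw [mass_of_rep _ hx]
      simp [ht']
  · have ha : a ∈ A := by
      by_contra hc
      rw [← ht] at h
      simp [hc] at h
    refine ⟨a, ha, ?_⟩
    rw [mass_of_rep _ hx]
    simp [← ht]

/-- A point with positive weight in a component of `G - S` has its other weight in `S`. -/
theorem IsComp.mass_add_eq_one {G : SimpleGraph V} {S : Finset V} {C : Set V} (hC : IsComp G S C)
    {x : Point G} (h : 0 < mass G C x) : mass G C x + mass G S x = 1 := by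
  obtain ⟨a, b, t, hab, hx⟩ := x.exists_rep
  rw [mass_of_rep _ hx] at h ⊢
  rw [mass_of_rep _ hx]
  have ha : a ∈ C → a ∉ (S : Set V) := fun h1 => hC.notMem h1
  have hb : b ∈ C → b ∉ (S : Set V) := fun h1 => hC.notMem h1
  rcases hab with rfl | hab
  · have haC : a ∈ C := by
      by_contra hc
      simp [hc] at h
    simp [haC, ha haC]
  · have h1 : a ∈ C → b ∉ (S : Set V) → b ∈ C := fun h1 h2 => hC.mem_of_adj h1 hab h2
    have h2 : b ∈ C → a ∉ (S : Set V) → a ∈ C := fun h1 h2 => hC.mem_of_adj h1 hab.symm h2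
    by_cases h3 : a ∈ C <;> by_cases h4 : b ∈ C
    · simp [h3, h4, ha h3, hb h4]
    · have : b ∈ (S : Set V) := by by_contra hc; exact h4 (h1 h3 hc)
      simp only [Set.indicator_of_mem h3, Set.indicator_of_notMem h4,
        Set.indicator_of_notMem (ha h3), Set.indicator_of_mem this]
      simp
    · have : a ∈ (S : Set V) := by by_contra hc; exact h3 (h2 h4 hc)
      simp only [Set.indicator_of_mem h4, Set.indicator_of_notMem h3,
        Set.indicator_of_notMem (hb h4), Set.indicator_of_mem this]
      simp
    · simp [h3, h4] at h

/-! ### Sets of small diameter -/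

section Small

variable {G : SimpleGraph V} {w : V → ℝ}

theorem edist_edgePt_le {ℓ : G.edgeSet → ℝ} {u v : V} (h : G.Adj u v) (s t : unitInterval) :
    lengthEDist ℓ (edgePt h s) (edgePt h t) ≤
      ENNReal.ofReal (ℓ ⟨s(u, v), h⟩ * |(s : ℝ) - t|) := by
  simpa using lengthEDist_le_of_route (.cons h s t (.refl _) : Route ℓ _ _ _)

/-- Each edge contributes half the weight of both ends. The half weight saved at the start of a walk
pays for that end of a preceding edge, which keeps the induction going. -/
theorem exists_route_of_walk (hw : ∀ v, 0 < w v) {u v : V} (p : G.Walk u v) :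
    ∃ r, Route (meanLength G w) (vtx G u) (vtx G v) r ∧
      r ≤ (p.support.map w).sum - w u / 2 := by
  induction p with
  | nil => exact ⟨0, .refl _, by simpa using (hw _).le⟩
  | @cons a b c h p ih =>
    obtain ⟨r, hr, hle⟩ := ih
    rw [← edgePt_one h] at hr
    have := Route.cons h 0 1 hr
    rw [edgePt_zero] at this
    refine ⟨_, this, ?_⟩
    rw [meanLength_mk]
    simp
    linarith

/-- All finite sets of vertices outside `S` have total weight at most `r`. -/
def SmallOff (w : V → ℝ) (S : Finset V) (r : ℝ) : Prop :=
  ∀ T : Finset V, Disjoint T S → ∑ v ∈ T, w v ≤ r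

theorem SmallOff.mono {S T : Finset V} {r : ℝ} (h : SmallOff w S r) (hST : S ⊆ T) :
    SmallOff w T r :=
  fun U hU => h U (hU.mono_right hST)

theorem SmallOff.le {S : Finset V} {r : ℝ} (h : SmallOff w S r) {v : V} (hv : v ∉ S) : w v ≤ r := by
  simpa using h {v} (by simpa using hv)

theorem exists_smallOff (hs : Summable w) {r : ℝ} (hr : 0 < r) : ∃ S, SmallOff w S r := by
  obtain ⟨S, hS⟩ := summable_iff_vanishing_norm.1 hs r hr
  exact ⟨S, fun T hT => (le_abs_self _).trans (hS T hT).le⟩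

/-- Shortening the walk to a path makes its vertices distinct, so their weights form a sum over a
finite set disjoint from `S`. -/
theorem edist_vtx_le_of_joined (hw : ∀ v, 0 < w v) {S : Finset V} {r : ℝ} (hS : SmallOff w S r)
    {u v : V} (h : Joined G S u v) :
    lengthEDist (meanLength G w) (vtx G u) (vtx G v) ≤
      ENNReal.ofReal r := by
  classical
  obtain ⟨p, hp⟩ := h
  obtain ⟨r', hr', hle⟩ := exists_route_of_walk hw p.bypass
  refine (lengthEDist_le_of_route hr').trans (ENNReal.ofReal_le_ofReal ?_)
  have h1 : (p.bypass.support.map w).sum ≤ r := by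
    rw [← List.sum_toFinset w p.bypass_isPath.support_nodup]
    refine hS _ (Finset.disjoint_left.2 fun x hx => hp x ?_)
    exact p.support_bypass_subset_support (List.mem_toFinset.1 hx)
  have := hw u
  linarith

/-- Move along the edge to an endpoint in `C`. If both endpoints are in `C`, the whole edge is
short. Otherwise the fraction of the edge to be traversed is less than `η`. -/
theorem exists_vtx_near (hw : ∀ v, 0 < w v) {C : Set V} {M r η : ℝ} (hM : ∀ v, w v ≤ M)
    (hC : ∀ u ∈ C, ∀ v ∈ C, G.Adj u v → (w u + w v) / 2 ≤ r) (h0 : 0 ≤ r)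
    (hη : η ≤ 1) (hηM : η * M ≤ r) {x : Point G} (hx : 1 - η < mass G C x) :
    ∃ u ∈ C, lengthEDist (meanLength G w) x (vtx G u) ≤ ENNReal.ofReal r := by
  have key : ∀ (a b : V) (h : G.Adj a b) (t : unitInterval), a ∈ C →
      1 - η < mass G C (edgePt h t) → ∃ u ∈ C, lengthEDist (meanLength G w) (edgePt h t)
        (vtx G u) ≤ ENNReal.ofReal r := by
    intro a b h t ha hm
    refine ⟨a, ha, ?_⟩
    have h1 := t.2.1
    have h2 := t.2.2
    have ha' := hw a
    have hb' := hw b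
    rw [← edgePt_zero h]
    refine (edist_edgePt_le h t 0).trans (ENNReal.ofReal_le_ofReal ?_)
    rw [meanLength_mk]
    simp only [Set.Icc.coe_zero, sub_zero, abs_of_nonneg h1]
    rw [mass_edgePt] at hm
    by_cases hb : b ∈ C
    · have := hC a ha b hb h
      nlinarith
    · simp [ha, hb] at hm
      have := hM a
      have := hM b
      nlinarith
  obtain ⟨a, b, t, rfl | hab, h⟩ := x.exists_rep
  · have hxa : x = vtx G a := Subtype.ext (by rw [h, vtx, ← Finsupp.single_add]; simp)
    subst hxa
    refine ⟨a, ?_, by simp [lengthEDist_self]⟩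
    by_contra hc
    rw [mass_vtx] at hx
    simp [hc] at hx
    linarith
  · obtain rfl : x = edgePt hab t := Subtype.ext h
    by_cases ha : a ∈ C
    · exact key a b hab t ha hx
    · by_cases hb : b ∈ C
      · rw [← edgePt_symm] at hx ⊢
        exact key b a hab.symm _ hb hx
      · rw [mass_edgePt] at hx
        simp [ha, hb] at hx
        linarith

/-- Three moves of length at most `r`: from `x` to a vertex of `C`, through `G - S` to another one,
and on to `y`. -/
theorem IsComp.edist_le (hw : ∀ v, 0 < w v) {S : Finset V} {C : Set V} (hC : IsComp G S C)
    {M r η : ℝ} (hM : ∀ v, w v ≤ M) (hS : SmallOff w S r) (h0 : 0 ≤ r)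
    (hη : η ≤ 1) (hηM : η * M ≤ r) {x y : Point G} (hx : 1 - η < mass G C x)
    (hy : 1 - η < mass G C y) : lengthEDist (meanLength G w) x y ≤ ENNReal.ofReal (3 * r) := by
  have h1 : ∀ u ∈ C, ∀ v ∈ C, G.Adj u v → (w u + w v) / 2 ≤ r := by
    intro u hu v hv _
    linarith [hS.le (hC.notMem hu), hS.le (hC.notMem hv)]
  obtain ⟨u, hu, hxu⟩ := exists_vtx_near hw hM h1 h0 hη hηM hx
  obtain ⟨v, hv, hyv⟩ := exists_vtx_near hw hM h1 h0 hη hηM hy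
  have huv := edist_vtx_le_of_joined hw hS ((hC u hu v).1 hv)
  rw [lengthEDist_comm] at hyv
  calc lengthEDist (meanLength G w) x y ≤ _ := (lengthEDist_triangle _ x _ y).trans
        (add_le_add (lengthEDist_triangle _ x _ _) le_rfl)
    _ ≤ _ := add_le_add (add_le_add hxu huv) hyv
    _ = ENNReal.ofReal (3 * r) := by
      rw [← ENNReal.ofReal_add h0 h0, ← ENNReal.ofReal_add (by linarith) h0]
      congr 1; ring

theorem edist_le_of_mass_singleton (hw : ∀ v, 0 < w v) {v : V}
    {M r η : ℝ} (hM : ∀ v, w v ≤ M) (h0 : 0 ≤ r)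
    (hη : η ≤ 1) (hηM : η * M ≤ r) {x y : Point G} (hx : 1 - η < mass G {v} x)
    (hy : 1 - η < mass G {v} y) : lengthEDist (meanLength G w) x y ≤ ENNReal.ofReal (2 * r) := by
  have h1 : ∀ a ∈ ({v} : Set V), ∀ b ∈ ({v} : Set V), G.Adj a b → (w a + w b) / 2 ≤ r := by
    rintro a rfl b rfl h
    exact (h.ne rfl).elim
  obtain ⟨_, rfl, hxu⟩ := exists_vtx_near hw hM h1 h0 hη hηM hx
  obtain ⟨_, rfl, hyv⟩ := exists_vtx_near hw hM h1 h0 hη hηM hy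
  rw [lengthEDist_comm] at hyv
  calc lengthEDist (meanLength G w) x y ≤ _ := lengthEDist_triangle _ x _ y
    _ ≤ _ := add_le_add hxu hyv
    _ = ENNReal.ofReal (2 * r) := by
      rw [← ENNReal.ofReal_add h0 h0]
      congr 1; ring

theorem edist_le_of_tent_pos (hw : ∀ v, 0 < w v) {u v : V} (huv : u ≠ v) {M r η c : ℝ}
    (hM : ∀ v, w v ≤ M) (hηM : η * M ≤ r) {x y : Point G}
    (hx : 0 < tent G u v x) (hy : 0 < tent G u v y) (hx' : |mass G {v} x - c| < η)
    (hy' : |mass G {v} y - c| < η) : lengthEDist (meanLength G w) x y ≤ ENNReal.ofReal (2 * r) := by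
  obtain ⟨h, s, -, -, rfl⟩ := eq_edgePt_of_pos huv (lt_min_iff.1 hx).1 (lt_min_iff.1 hx).2
  obtain ⟨_, t, -, -, rfl⟩ := eq_edgePt_of_pos huv (lt_min_iff.1 hy).1 (lt_min_iff.1 hy).2
  refine (edist_edgePt_le h s t).trans (ENNReal.ofReal_le_ofReal ?_)
  simp only [mass_edgePt, Set.mem_singleton_iff, huv, not_false_eq_true, Set.indicator_of_notMem,
    mul_zero, Set.indicator_of_mem, Pi.one_apply, mul_one, zero_add] at hx' hy'
  have h1 := abs_sub_le (s : ℝ) c t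
  rw [abs_sub_comm c] at h1
  rw [meanLength_mk]
  have := hM u
  have := hM v
  have := hw u
  have := hw v
  have h3 : |(s : ℝ) - t| ≤ 2 * η := by linarith
  have h4 := abs_nonneg ((s : ℝ) - t)
  calc (w u + w v) / 2 * |(s : ℝ) - t| ≤ M * (2 * η) := by gcongr <;> linarith
    _ ≤ 2 * r := by linarith

end Small

/-! ### Rays from nested connected sets -/

/-- A decreasing sequence of connected sets of vertices with empty intersection contains a ray
with a tail in each of the sets: follow shortest walks from each set to the next one. -/
theorem exists_ray_of_antitone {G : SimpleGraph V} {C : ℕ → Set V} (hC : Antitone C)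
    (hne : ∀ n, (C n).Nonempty) (hempty : ∀ v, ∃ n, v ∉ C n)
    (hconn : ∀ n, ∀ u ∈ C n, ∀ v ∈ C n, ∃ p : G.Walk u v, ∀ x ∈ p.support, x ∈ C n) :
    ∃ R : Ray G, ∀ n, ∃ m, ∀ i ≥ m, R.toFun i ∈ C n := by
  classical
  -- The lengths of walks inside `C n` from `v` to the next set; the infimum is the distance still
  -- to go.
  let D : ℕ → V → Set ℕ := fun n v =>
    {k | ∃ y ∈ C (n + 1), ∃ p : G.Walk v y, (∀ x ∈ p.support, x ∈ C n) ∧ p.length = k}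
  have step : ∀ v, ∃ y, v ∈ C 0 → G.Adj v y ∧ ∀ n, v ∈ C n → v ∉ C (n + 1) →
      y ∈ C n ∧ (y ∈ C (n + 1) ∨ sInf (D n y) < sInf (D n v)) := by
    intro v
    by_cases hv : v ∈ C 0
    swap
    · exact ⟨v, fun h => absurd h hv⟩
    -- This `n` is the index of the last set containing `v`. The successor of `v` is the second
    -- vertex of a shortest walk to the next set.
    obtain ⟨n, hn, hn'⟩ : ∃ n, v ∈ C n ∧ v ∉ C (n + 1) := by
      have hfind := Nat.find_spec (hempty v)
      obtain ⟨k, hk⟩ : ∃ k, Nat.find (hempty v) = k + 1 :=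
        Nat.exists_eq_succ_of_ne_zero fun h0 => by rw [h0] at hfind; exact hfind hv
      refine ⟨k, ?_, hk ▸ hfind⟩
      have := Nat.find_min (hempty v) (m := k) (by omega)
      exact not_not.1 this
    have hD : (D n v).Nonempty := by
      obtain ⟨y, hy⟩ := hne (n + 1)
      obtain ⟨p, hp⟩ := hconn n v hn y (hC n.le_succ hy)
      exact ⟨_, y, hy, p, hp, rfl⟩
    obtain ⟨y, hy, p, hp, hlen⟩ := Nat.sInf_mem hD
    cases p with
    | nil => exact absurd hy hn'
    | @cons _ b _ h p =>
      have hp' : ∀ x ∈ p.support, x ∈ C n := fun x hx => hp x (by simp [hx])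
      refine ⟨b, fun _ => ⟨h, fun m hm hm' => ?_⟩⟩
      have hmn : m = n := by
        by_contra hc
        rcases Nat.lt_or_gt_of_ne hc with hlt | hlt
        · exact hm' (hC hlt hn)
        · exact hn' (hC hlt hm)
      subst hmn
      refine ⟨hp' _ p.start_mem_support, Or.inr ?_⟩
      have h1 : sInf (D m b) ≤ p.length := Nat.sInf_le ⟨y, hy, p, hp', rfl⟩
      rw [SimpleGraph.Walk.length_cons] at hlen
      omega
  choose g hg using step
  have hstay : ∀ n v, v ∈ C n → g v ∈ C n := by
    intro n v hv
    -- The step property speaks only of the last set containing `v`, so the induction on `k`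
    -- descends to that index.
    obtain ⟨k, hk⟩ : ∃ k, v ∉ C (n + k + 1) := by
      obtain ⟨k, hk⟩ := hempty v
      exact ⟨k, fun h => hk (hC (by omega) h)⟩
    induction k with
    | zero => exact (((hg v) (hC n.zero_le hv)).2 n hv hk).1
    | succ k ih =>
      by_cases h : v ∈ C (n + k + 1)
      · exact hC (by omega) (((hg v) (hC n.zero_le hv)).2 (n + k + 1) h hk).1
      · exact ih h
  have hstays : ∀ n v, v ∈ C n → ∀ i, g^[i] v ∈ C n := by
    intro n v hv i
    induction i with
    | zero => exact hv
    | succ i ih => rw [Function.iterate_succ_apply']; exact hstay n _ ih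
  have hnext : ∀ n k v, v ∈ C n → sInf (D n v) = k → ∃ i, g^[i] v ∈ C (n + 1) := by
    intro n k
    induction k using Nat.strong_induction_on with
    | _ k ih =>
      intro v hv hk
      by_cases h : v ∈ C (n + 1)
      · exact ⟨0, h⟩
      obtain ⟨h1, h2⟩ := (hg v (hC n.zero_le hv)).2 n hv h
      rcases h2 with h2 | h2
      · exact ⟨1, h2⟩
      · obtain ⟨i, hi⟩ := ih _ (hk ▸ h2) (g v) h1 rfl
        exact ⟨i + 1, hi⟩
  obtain ⟨v₀, hv₀⟩ := hne 0
  have hall : ∀ n, ∃ i, g^[i] v₀ ∈ C n := by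
    intro n
    induction n with
    | zero => exact ⟨0, hv₀⟩
    | succ n ih =>
      obtain ⟨i, hi⟩ := ih
      obtain ⟨j, hj⟩ := hnext n _ _ hi rfl
      exact ⟨j + i, by rwa [Function.iterate_add_apply]⟩
  have htail : ∀ n, ∃ m, ∀ i ≥ m, g^[i] v₀ ∈ C n := by
    intro n
    obtain ⟨m, hm⟩ := hall n
    refine ⟨m, fun i hi => ?_⟩
    obtain ⟨k, rfl⟩ := Nat.exists_eq_add_of_le' hi
    rw [Function.iterate_add_apply]
    exact hstays n _ hm k
  -- A repeated vertex would recur periodically, hence lie in every tail and so in every `C n`,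
  -- against the empty intersection.
  have hinj : ∀ i k, g^[i] v₀ ≠ g^[k + 1 + i] v₀ := by
    intro i k h
    have hper : Function.IsPeriodicPt g (k + 1) (g^[i] v₀) := by
      rw [Function.IsPeriodicPt, Function.IsFixedPt, ← Function.iterate_add_apply, ← h]
    obtain ⟨n, hn⟩ := hempty (g^[i] v₀)
    obtain ⟨m, hm⟩ := htail n
    refine hn ?_
    have h1 := hm ((k + 1) * m + i) (by nlinarith)
    rwa [Function.iterate_add_apply, (hper.mul_const m).eq] at h1
  refine ⟨⟨fun i => g^[i] v₀, fun i j h => ?_, fun n => ?_⟩, htail⟩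
  · rcases lt_trichotomy i j with hij | hij | hij
    · obtain ⟨k, rfl⟩ := Nat.exists_eq_add_of_lt hij
      exact absurd h (by convert hinj i k using 3; omega)
    · exact hij
    · obtain ⟨k, rfl⟩ := Nat.exists_eq_add_of_lt hij
      exact absurd h.symm (by convert hinj j k using 3; omega)
  · rw [Function.iterate_succ_apply']
    exact (hg _ (hstays 0 _ hv₀ n)).1

/-! ### Basic open sets in terms of masses -/

section PointSets

variable {G : SimpleGraph V}

theorem eq_vtx_or_edgePt_of_pos {v : V} {x : Point G} (h : 0 < mass G {v} x) :
    x = vtx G v ∨ ∃ (u : V) (h : G.Adj v u) (t : unitInterval), x = edgePt h t := by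
  obtain ⟨a, b, t, rfl | hab, hx⟩ := x.exists_rep
  · have hxa : x = vtx G a := Subtype.ext (by rw [hx, vtx, ← Finsupp.single_add]; simp)
    subst hxa
    rw [mass_vtx] at h
    by_cases hav : a = v
    · exact Or.inl (hav ▸ rfl)
    · simp [hav] at h
  · obtain rfl : x = edgePt hab t := Subtype.ext hx
    rw [mass_edgePt] at h
    by_cases hav : a = v
    · subst hav
      exact Or.inr ⟨b, hab, t, rfl⟩
    · by_cases hbv : b = v
      · subst hbv
        exact Or.inr ⟨a, hab.symm, _, (edgePt_symm hab t).symm⟩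
      · simp [hav, hbv] at h

theorem point_mem_openStar_iff {v : V} {ε : ℝ} (h0 : 0 < ε) (h1 : ε < 1) {x : Point G} :
    MTop.point x ∈ openStar G v ε ↔ 1 - ε < mass G {v} x := by
  constructor
  · rintro (h | ⟨u, h, t, ht, hx⟩)
    · obtain rfl := MTop.point.inj h
      rw [mass_vtx]
      simpa using h0
    · obtain rfl := MTop.point.inj hx
      simp [mass_edgePt, h.ne']
      exact ht
  · intro h
    rcases eq_vtx_or_edgePt_of_pos (by linarith : 0 < mass G {v} x) with rfl | ⟨u, hu, t, rfl⟩
    · exact Or.inl rfl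
    · refine Or.inr ⟨u, hu, t, ?_, rfl⟩
      simp [mass_edgePt, hu.ne'] at h
      exact h

theorem point_mem_edgeSub_iff {u v : V} (h : G.Adj u v) {U : Set ℝ} {x : Point G} :
    MTop.point x ∈ edgeSub h (Subtype.val ⁻¹' U) ↔
      0 < mass G {u} x ∧ 0 < mass G {v} x ∧ mass G {v} x ∈ U := by
  have key : ∀ t : unitInterval, mass G {u} (edgePt h t) = 1 - t ∧ mass G {v} (edgePt h t) = t :=
    fun t => by simp [mass_edgePt, h.ne, h.ne']
  constructor
  · rintro ⟨t, htU, h0, h1, hx⟩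
    obtain rfl := MTop.point.inj hx
    rw [(key t).1, (key t).2]
    exact ⟨sub_pos.2 h1, h0, htU⟩
  · rintro ⟨hu, hv, hU⟩
    obtain ⟨_, t, h0, h1, rfl⟩ := eq_edgePt_of_pos h.ne hu hv
    rw [(key t).2] at hU
    exact ⟨t, hU, h0, h1, rfl⟩

/-- The maximum with 0 matters when `ε > 1`: points of zero weight in the component, such as
vertices of `S`, must stay excluded. -/
theorem point_mem_endNhd_iff {S : Finset V} {ω : VertexEnd G} {ε : ℝ} {x : Point G} (h0 : 0 < ε) :
    MTop.point x ∈ endNhd G S ω ε ↔ max 0 (1 - ε) < mass G (compVerts G S ω) x := by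
  have hC := isComp_compVerts G S ω
  rw [max_lt_iff]
  constructor
  · rintro (⟨v, hv, hx⟩ | ⟨u, hu, v, hv, h, t, hx⟩ | ⟨_, _, _, _, hx⟩ |
      ⟨u, hu, v, hv, h, t, ht0, ht1, htε, hx⟩)
    · obtain rfl := MTop.point.inj hx
      simpa [mass_vtx, hv] using h0
    · obtain rfl := MTop.point.inj hx
      simpa [mass_edgePt, hu, hv] using h0
    · cases hx
    · obtain rfl := MTop.point.inj hx
      have hv' : v ∉ compVerts G S ω := fun h => hC.notMem h hv
      simp [mass_edgePt, hu, hv']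
      exact ⟨ht1, htε⟩
  · rintro ⟨hpos, hε⟩
    have key : ∀ (a b : V) (h : G.Adj a b) (t : unitInterval), a ∈ compVerts G S ω →
        1 - ε < mass G (compVerts G S ω) (edgePt h t) →
        0 < mass G (compVerts G S ω) (edgePt h t) →
        MTop.point (edgePt h t) ∈ endNhd G S ω ε := by
      intro a b h t ha hε hpos
      by_cases hb : b ∈ compVerts G S ω
      · exact Or.inr (Or.inl ⟨a, ha, b, hb, h, t, rfl⟩)
      · have hbS : b ∈ S := (hC.boundary h ha hb).resolve_left (hC.notMem ha)
        simp [mass_edgePt, ha, hb] at hε hpos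
        rcases eq_or_ne t 0 with rfl | ht
        · rw [edgePt_zero]
          exact Or.inl ⟨a, ha, rfl⟩
        · exact Or.inr (Or.inr (Or.inr ⟨a, ha, b, hbS, h, t, unitInterval.pos_iff_ne_zero.2 ht,
            hpos, hε, rfl⟩))
    obtain ⟨a, ha, hax⟩ := exists_mem_of_mass_pos hpos
    rcases eq_vtx_or_edgePt_of_pos hax with rfl | ⟨u, hu, t, rfl⟩
    · exact Or.inl ⟨a, ha, rfl⟩
    · exact key a u hu t ha hε hpos

theorem mass_compl_add (S : Set V) (x : Point G) : mass G Sᶜ x + mass G S x = 1 := by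
  obtain ⟨a, b, t, -, hx⟩ := x.exists_rep
  rw [mass_of_rep _ hx, mass_of_rep _ hx]
  by_cases ha : a ∈ S <;> by_cases hb : b ∈ S <;> simp [ha, hb]

theorem mass_pos_of_mem {A : Set V} {u : V} (hu : u ∈ A) {x : Point G} (h : 0 < mass G {u} x) :
    0 < mass G A x := by
  rcases eq_vtx_or_edgePt_of_pos h with rfl | ⟨b, hb, t, rfl⟩
  · simp [mass_vtx, hu]
  · have h0 := t.2.1
    simp [mass_edgePt, hb.ne'] at h
    rw [mass_edgePt]
    by_cases hbA : b ∈ A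
    · simp [hu, hbA]
    · simp [hu, hbA]
      exact h

/-- Initial segments of a walk avoiding `S` show that all its vertices belong to `C`. -/
theorem IsComp.exists_walk {S : Finset V} {C : Set V} (hC : IsComp G S C) {u v : V} (hu : u ∈ C)
    (hv : v ∈ C) : ∃ p : G.Walk u v, ∀ x ∈ p.support, x ∈ C := by
  classical
  obtain ⟨p, hp⟩ := (hC u hu v).1 hv
  exact ⟨p, fun x hx => (hC u hu x).2
    ⟨p.takeUntil x hx, fun y hy => hp y (p.support_takeUntil_subset_support hx hy)⟩⟩

end PointSets

/-! ### Masses on the completion -/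

section Completion

open UniformSpace Topology Filter Uniformity

variable {G : SimpleGraph V}

theorem isUniformInducing_toLTop (ℓ : G.edgeSet → ℝ) :
    IsUniformInducing (α := LPoint ℓ) (toLTop ℓ) :=
  (Completion.isUniformInducing_coe _).comp SeparationQuotient.isUniformInducing_mk

theorem denseRange_toLTop (ℓ : G.edgeSet → ℝ) : DenseRange (α := LPoint ℓ) (toLTop ℓ) :=
  Completion.denseRange_coe.comp SeparationQuotient.surjective_mk.denseRange
    (Completion.continuous_coe _)

/-- The continuous extension of a function on the 1-complex to `|G|_ℓ`. -/
noncomputable def extL (ℓ : G.edgeSet → ℝ) (f : Point G → ℝ) : LTop ℓ → ℝ :=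
  extendAlong (isUniformInducing_toLTop ℓ) (denseRange_toLTop ℓ) f

theorem extL_toLTop {ℓ : G.edgeSet → ℝ} {K : ℝ} {f : Point G → ℝ} (hf : IsLip (α := LPoint ℓ) K f)
    (x : Point G) : extL ℓ f (toLTop ℓ x) = f x :=
  extendAlong_apply (isUniformInducing_toLTop ℓ) (denseRange_toLTop ℓ) hf x

theorem continuous_extL {ℓ : G.edgeSet → ℝ} {K : ℝ} {f : Point G → ℝ}
    (hf : IsLip (α := LPoint ℓ) K f) : Continuous (extL ℓ f) :=
  continuous_extendAlong (isUniformInducing_toLTop ℓ) (denseRange_toLTop ℓ) hf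

theorem subset_of_toLTop {ℓ : G.edgeSet → ℝ} {O F : Set (LTop ℓ)} (hO : IsOpen O) (hF : IsClosed F)
    (h : ∀ x : Point G, toLTop ℓ x ∈ O → toLTop ℓ x ∈ F) : O ⊆ F :=
  subset_of_denseRange (denseRange_toLTop ℓ) hO hF h

/-- The edge boundary of `A` is covered by finitely many vertices. -/
def FinBoundary (G : SimpleGraph V) (A : Set V) : Prop :=
  ∃ S : Finset V, ∀ u v, G.Adj u v → u ∈ A → v ∉ A → u ∈ S ∨ v ∈ S

theorem finBoundary_finset (G : SimpleGraph V) (S : Finset V) : FinBoundary G (S : Set V) :=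
  ⟨S, fun _ _ _ hu _ => Or.inl hu⟩

theorem finBoundary_singleton (G : SimpleGraph V) (v : V) : FinBoundary G {v} := by
  simpa using finBoundary_finset G {v}

theorem IsComp.finBoundary {S : Finset V} {C : Set V} (hC : IsComp G S C) : FinBoundary G C :=
  ⟨S, fun _ _ h hu hv => hC.boundary h hu hv⟩

/-- The extension of the weight of `A` to the completion. -/
noncomputable def massL (G : SimpleGraph V) (w : V → ℝ) (A : Set V) : LTop (meanLength G w) → ℝ :=
  extL (meanLength G w) (mass G A)

variable {w : V → ℝ} (hw : ∀ v, 0 < w v)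

include hw

theorem FinBoundary.massL_toLTop {A : Set V} (hA : FinBoundary G A) (x : Point G) :
    massL G w A (toLTop _ x) = mass G A x := by
  obtain ⟨S, hS⟩ := hA
  exact extL_toLTop (isLip_mass hw hS) x

theorem FinBoundary.continuous_massL {A : Set V} (hA : FinBoundary G A) :
    Continuous (massL G w A) := by
  obtain ⟨S, hS⟩ := hA
  exact continuous_extL (isLip_mass hw hS)

theorem massL_nonneg {A : Set V} (hA : FinBoundary G A) (z : LTop (meanLength G w)) :
    0 ≤ massL G w A z := by
  refine subset_of_toLTop isOpen_univ
    (isClosed_le continuous_const (hA.continuous_massL hw)) (fun x _ => ?_) (Set.mem_univ z)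
  simpa [hA.massL_toLTop hw] using mass_nonneg A x

theorem massL_add_le_one {A B : Set V} (hA : FinBoundary G A) (hB : FinBoundary G B)
    (h : Disjoint A B) (z : LTop (meanLength G w)) : massL G w A z + massL G w B z ≤ 1 := by
  refine subset_of_toLTop (F := {z | massL G w A z + massL G w B z ≤ 1}) isOpen_univ
    (isClosed_le ((hA.continuous_massL hw).add (hB.continuous_massL hw)) continuous_const)
    (fun x _ => ?_) (Set.mem_univ z)
  simpa [hA.massL_toLTop hw, hB.massL_toLTop hw] using mass_add_le_one h x

theorem massL_le_one {A : Set V} (hA : FinBoundary G A) (z : LTop (meanLength G w)) :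
    massL G w A z ≤ 1 := by
  have h0 : FinBoundary G (∅ : Set V) := ⟨∅, fun _ _ _ h => h.elim⟩
  have := massL_add_le_one hw hA h0 (Set.disjoint_empty A) z
  linarith [massL_nonneg hw h0 z]

theorem massL_finset (S : Finset V) (z : LTop (meanLength G w)) :
    massL G w S z = ∑ v ∈ S, massL G w {v} z := by
  refine subset_of_toLTop (F := {z | massL G w S z = ∑ v ∈ S, massL G w {v} z}) isOpen_univ
    (isClosed_eq ((finBoundary_finset G S).continuous_massL hw)
      (continuous_finsetSum _ fun v _ => (finBoundary_singleton G v).continuous_massL hw))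
    (fun x _ => ?_) (Set.mem_univ z)
  simp only [Set.mem_ofPred_eq, (finBoundary_finset G S).massL_toLTop hw,
    (finBoundary_singleton G _).massL_toLTop hw, mass_coe_finset]

/-- The identity holds at the points of `G` in an open set, and a closed condition extends from
there to the whole open set. Thus a limit with some weight in `C` and none in `S` has weight exactly
1 in `C`. -/
theorem IsComp.massL_add_eq_one {S : Finset V} {C : Set V} (hC : IsComp G S C)
    {z : LTop (meanLength G w)} (hz : 0 < massL G w C z) :
    massL G w C z + massL G w S z = 1 := by
  have h1 := hC.finBoundary
  have h2 := finBoundary_finset G S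
  refine subset_of_toLTop (O := {z | 0 < massL G w C z})
    (F := {z | massL G w C z + massL G w S z = 1})
    (isOpen_lt continuous_const (h1.continuous_massL hw))
    (isClosed_eq ((h1.continuous_massL hw).add (h2.continuous_massL hw)) continuous_const)
    (fun x hx => ?_) hz
  simp only [Set.mem_ofPred_eq, h1.massL_toLTop hw, h2.massL_toLTop hw] at hx ⊢
  exact hC.mass_add_eq_one hx

omit hw in
/-- The points of a small open set are close together. -/
def SmallSet (ℓ : G.edgeSet → ℝ) (r : ℝ) (O : Set (LTop ℓ)) : Prop :=
  ∀ x y : Point G, toLTop ℓ x ∈ O → toLTop ℓ y ∈ O → lengthEDist ℓ x y ≤ ENNReal.ofReal r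

omit hw in
theorem eq_of_forall_smallSet {ℓ : G.edgeSet → ℝ} {z z' : LTop ℓ}
    (h : ∀ r : ℝ, 0 < r → ∃ O : Set (LTop ℓ), IsOpen O ∧ z ∈ O ∧ z' ∈ O ∧ SmallSet ℓ r O) :
    z = z' :=
  eq_of_forall_small (isUniformInducing_toLTop ℓ) (denseRange_toLTop ℓ) h

omit hw in
theorem exists_near_toLTop {ℓ : G.edgeSet → ℝ} (z : LTop ℓ) {δ : ℝ} (hδ : 0 < δ) :
    ∃ x : Point G, ∀ (K : ℝ) (f : Point G → ℝ), IsLip (α := LPoint ℓ) K f →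
      |extL ℓ f z - f x| ≤ K * δ := by
  obtain ⟨x, -, hx⟩ := exists_near (isUniformInducing_toLTop ℓ) (denseRange_toLTop ℓ) isOpen_univ
    (Set.mem_univ z) hδ
  exact ⟨x, hx⟩

theorem smallSet_vtx (v : V) {M r η : ℝ} (hM : ∀ v, w v ≤ M) (h0 : 0 ≤ r)
    (hη : η ≤ 1) (hηM : η * M ≤ r) :
    SmallSet (meanLength G w) (2 * r) {z | 1 - η < massL G w {v} z} := by
  intro x y hx hy
  rw [Set.mem_ofPred_eq, (finBoundary_singleton G v).massL_toLTop hw] at hx hy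
  exact edist_le_of_mass_singleton hw hM h0 hη hηM hx hy

theorem IsComp.smallSet {S : Finset V} {C : Set V} (hC : IsComp G S C) {M r η : ℝ}
    (hM : ∀ v, w v ≤ M) (hS : SmallOff w S r) (h0 : 0 ≤ r) (hη : η ≤ 1) (hηM : η * M ≤ r) :
    SmallSet (meanLength G w) (3 * r) {z | 1 - η < massL G w C z} := by
  intro x y hx hy
  rw [Set.mem_ofPred_eq, hC.finBoundary.massL_toLTop hw] at hx hy
  exact hC.edist_le hw hM hS h0 hη hηM hx hy

omit hw in
/-- The set of points of the completion that lie on the edge `uv`, near the point `c`. -/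
def edgeNear (G : SimpleGraph V) (w : V → ℝ) (u v : V) (c η : ℝ) : Set (LTop (meanLength G w)) :=
  {z | 0 < massL G w {u} z ∧ 0 < massL G w {v} z ∧ massL G w {v} z ∈ Metric.ball c η}

theorem isOpen_edgeNear (u v : V) (c η : ℝ) : IsOpen (edgeNear G w u v c η) :=
  (isOpen_lt continuous_const ((finBoundary_singleton G u).continuous_massL hw)).inter
    ((isOpen_lt continuous_const ((finBoundary_singleton G v).continuous_massL hw)).inter
      (Metric.isOpen_ball.preimage ((finBoundary_singleton G v).continuous_massL hw)))

theorem smallSet_edgeNear {u v : V} (huv : u ≠ v) {M r η : ℝ} (c : ℝ)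
    (hM : ∀ v, w v ≤ M) (hηM : η * M ≤ r) :
    SmallSet (meanLength G w) (2 * r) (edgeNear G w u v c η) := by
  rintro x y ⟨hx1, hx2, hx3⟩ ⟨hy1, hy2, hy3⟩
  rw [Metric.mem_ball, Real.dist_eq] at hx3 hy3
  rw [(finBoundary_singleton G _).massL_toLTop hw] at hx1 hx2 hx3 hy1 hy2 hy3
  exact edist_le_of_tent_pos hw huv hM hηM (lt_min hx1 hx2) (lt_min hy1 hy2) hx3 hy3

omit hw in
theorem exists_bound (hs : Summable w) (hw : ∀ v, 0 < w v) {r : ℝ} (hr : 0 < r) :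
    ∃ M η : ℝ, (∀ v, w v ≤ M) ∧ 0 < η ∧ η < 1 ∧ η * M ≤ r := by
  have h0 : 0 ≤ ∑' v, w v := tsum_nonneg fun v => (hw v).le
  -- The total weight bounds each weight; the added `r + 1` ensures `η < 1`.
  refine ⟨∑' v, w v, r / (∑' v, w v + r + 1), fun v => hs.le_tsum v fun j _ => (hw j).le,
    by positivity, ?_, ?_⟩
  · rw [div_lt_one (by linarith)]
    linarith
  · rw [div_mul_eq_mul_div, div_le_iff₀ (by linarith)]
    nlinarith

/-! ### The limits of the ends -/

/-- The limit of the vertices of any ray of `ω`. They form a Cauchy sequence because a tail lies in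
one component of `G - S`, where `S` leaves little weight outside. For every `S` the ray is
eventually in `C(S, ω)`, so the weights there converge to 1. -/
theorem exists_endPoint (hs : Summable w) (ω : VertexEnd G) :
    ∃ z : LTop (meanLength G w), ∀ S, massL G w (compVerts G S ω) z = 1 := by
  obtain ⟨R, hR⟩ := ω.exists_ray
  have hc : CauchySeq (α := LPoint (meanLength G w)) fun n => vtx G (R.toFun n) := by
    refine EMetric.cauchySeq_iff.2 fun ε hε => ?_
    obtain ⟨r, hr0, hr⟩ := ENNReal.lt_iff_exists_nnreal_btwn.1 hε
    obtain ⟨S, hS⟩ := exists_smallOff hs (r := r) (by simpa using hr0)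
    obtain ⟨n, hn⟩ := hR.exists_forall_mem S
    refine ⟨n, fun i hi j hj => lt_of_le_of_lt ?_ hr⟩
    have := edist_vtx_le_of_joined hw hS
      ((isComp_compVerts G S ω _ (hn i hi) _).1 (hn j hj))
    rwa [ENNReal.ofReal_coe_nnreal] at this
  obtain ⟨z, hz⟩ := cauchySeq_tendsto_of_complete
    ((isUniformInducing_toLTop (meanLength G w)).uniformContinuous.comp_cauchySeq hc)
  refine ⟨z, fun S => ?_⟩
  have hb := (isComp_compVerts G S ω).finBoundary
  have h1 := ((hb.continuous_massL hw).tendsto z).comp hz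
  obtain ⟨n, hn⟩ := hR.exists_forall_mem S
  refine tendsto_nhds_unique (h1.congr' ?_) tendsto_const_nhds
  filter_upwards [eventually_ge_atTop n] with i hi
  refine (hb.massL_toLTop hw (vtx G (R.toFun i))).trans ?_
  rw [mass_vtx, Set.indicator_of_mem (hn i hi)]
  rfl

omit hw in
/-- The extension of the canonical map by the points `e ω` at the ends `ω`. -/
noncomputable def ofMTop (ℓ : G.edgeSet → ℝ) (e : VertexEnd G → LTop ℓ) : MTop G → LTop ℓ
  | .point x => toLTop ℓ x
  | .vend ω => e ω

variable {e : VertexEnd G → LTop (meanLength G w)}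
  (he : ∀ ω S, massL G w (compVerts G S ω) (e ω) = 1)

include he

theorem massL_singleton_end (v : V) (ω : VertexEnd G) : massL G w {v} (e ω) = 0 := by
  have hC := isComp_compVerts G {v} ω
  have h1 := massL_add_le_one hw (finBoundary_singleton G v) hC.finBoundary
    (Set.disjoint_singleton_left.2 fun h => hC.notMem h (Finset.mem_singleton_self v)) (e ω)
  have h2 := massL_nonneg hw (finBoundary_singleton G v) (e ω)
  rw [he] at h1
  linarith

/-- Distinct components are disjoint, and disjoint sets have total weight at most 1, all of which
`C(S, ω')` already takes at `e ω'`. -/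
theorem massL_compVerts_pos_iff (S : Finset V) (ω ω' : VertexEnd G) :
    0 < massL G w (compVerts G S ω) (e ω') ↔ compVerts G S ω' = compVerts G S ω := by
  have hC := isComp_compVerts G S ω
  have hC' := isComp_compVerts G S ω'
  constructor
  · intro h
    by_contra hne
    have hd : Disjoint (compVerts G S ω) (compVerts G S ω') :=
      Set.disjoint_left.2 fun u hu hu' => hne (hC'.eq hC hu' hu)
    have := massL_add_le_one hw hC.finBoundary hC'.finBoundary hd (e ω')
    rw [he] at this
    linarith
  · intro h
    rw [← h, he]
    exact one_pos

/-! ### Generators of `MTOP` as preimages of open sets of the completion -/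

theorem preimage_openStar (v : V) {ε : ℝ} (h0 : 0 < ε) (h1 : ε < 1) :
    ofMTop _ e ⁻¹' {z | 1 - ε < massL G w {v} z} = openStar G v ε := by
  ext (x | ω)
  · rw [point_mem_openStar_iff h0 h1, Set.mem_preimage, Set.mem_ofPred_eq, ofMTop,
      (finBoundary_singleton G v).massL_toLTop hw]
  · rw [Set.mem_preimage, Set.mem_ofPred_eq, ofMTop, massL_singleton_end hw he]
    refine ⟨fun h => absurd h (by linarith), ?_⟩
    rintro (h | ⟨_, _, _, _, h⟩) <;> cases h

theorem preimage_edgeSub {u v : V} (h : G.Adj u v) (U : Set ℝ) :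
    ofMTop _ e ⁻¹' {z | 0 < massL G w {u} z ∧ 0 < massL G w {v} z ∧ massL G w {v} z ∈ U} =
      edgeSub h (Subtype.val ⁻¹' U) := by
  ext (x | ω)
  · rw [point_mem_edgeSub_iff, Set.mem_preimage, Set.mem_ofPred_eq, ofMTop,
      (finBoundary_singleton G v).massL_toLTop hw, (finBoundary_singleton G u).massL_toLTop hw]
  · rw [Set.mem_preimage, Set.mem_ofPred_eq, ofMTop, massL_singleton_end hw he]
    refine ⟨fun h => absurd h.1 (lt_irrefl _), ?_⟩
    rintro ⟨_, _, _, _, h⟩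
    cases h

theorem preimage_endNhd (S : Finset V) (ω : VertexEnd G) {ε : ℝ} (h0 : 0 < ε) :
    ofMTop _ e ⁻¹' {z | max 0 (1 - ε) < massL G w (compVerts G S ω) z} = endNhd G S ω ε := by
  ext (x | ω')
  · rw [point_mem_endNhd_iff h0, Set.mem_preimage, Set.mem_ofPred_eq, ofMTop,
      (isComp_compVerts G S ω).finBoundary.massL_toLTop hw]
  · rw [Set.mem_preimage, Set.mem_ofPred_eq, ofMTop]
    constructor
    · intro h
      have := (massL_compVerts_pos_iff hw he S ω ω').1 (lt_of_le_of_lt (le_max_left _ _) h)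
      obtain ⟨R, hR, hR'⟩ := exists_ray_in_compVerts_iff.2 this
      exact Or.inr (Or.inr (Or.inl ⟨ω', R, hR, hR', rfl⟩))
    · rintro (⟨_, _, hx⟩ | ⟨_, _, _, _, _, _, hx⟩ | ⟨ω'', R, hR, hR', hx⟩ |
        ⟨_, _, _, _, _, _, _, _, _, hx⟩)
      · cases hx
      · cases hx
      · cases hx
        rw [← exists_ray_in_compVerts_iff.1 ⟨R, hR, hR'⟩, he]
        simpa using h0
      · cases hx

/-- The same condition on weights defines a small open set in the completion and a generator of
`MTOP`: a star at a vertex, a segment inside an edge, or a component neighbourhood at an end. -/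
theorem exists_small_nhd (hs : Summable w) (p : MTop G) {r : ℝ} (hr : 0 < r) :
    ∃ O : Set (LTop (meanLength G w)), IsOpen O ∧ SmallSet _ r O ∧ ofMTop _ e p ∈ O ∧
      IsOpen (ofMTop _ e ⁻¹' O) := by
  obtain ⟨M, η, hM, hη0, hη1, hηM⟩ := exists_bound hs hw (r := r / 3) (by positivity)
  have hmono : SmallSet (G := G) (meanLength G w) (2 * (r / 3)) ≤ SmallSet _ r :=
    fun O h x y hx hy => (h x y hx hy).trans (ENNReal.ofReal_le_ofReal (by linarith))
  have hvtx : ∀ v, ∃ O : Set (LTop (meanLength G w)), IsOpen O ∧ SmallSet _ r O ∧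
      ofMTop _ e (.point (vtx G v)) ∈ O ∧ IsOpen (ofMTop _ e ⁻¹' O) := by
    intro v
    have hpre := preimage_openStar hw he v hη0 hη1
    refine ⟨{z | 1 - η < massL G w {v} z},
      isOpen_lt continuous_const ((finBoundary_singleton G v).continuous_massL hw),
      hmono _ (smallSet_vtx hw v hM (by positivity) hη1.le hηM), ?_, ?_⟩
    · rw [← Set.mem_preimage, hpre]
      exact Or.inl rfl
    · rw [hpre]
      exact .basic _ (Or.inl (Or.inr ⟨v, η, hη0, hη1, rfl⟩))
  obtain (x | ω) := p
  · obtain ⟨v, hv⟩ := exists_mass_singleton_pos x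
    rcases eq_vtx_or_edgePt_of_pos hv with rfl | ⟨u, h, t, rfl⟩
    · exact hvtx v
    · rcases eq_or_ne t 0 with rfl | ht0
      · rw [edgePt_zero]
        exact hvtx v
      rcases eq_or_ne t 1 with rfl | ht1
      · rw [edgePt_one]
        exact hvtx u
      have hpre := preimage_edgeSub hw he h (Metric.ball (t : ℝ) η)
      refine ⟨edgeNear G w v u t η, isOpen_edgeNear hw v u t η,
        hmono _ (smallSet_edgeNear hw h.ne _ hM hηM), ?_, ?_⟩
      · rw [← Set.mem_preimage, edgeNear, hpre]
        exact ⟨t, Metric.mem_ball_self hη0, unitInterval.pos_iff_ne_zero.2 ht0,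
          unitInterval.lt_one_iff_ne_one.2 ht1, rfl⟩
      · rw [edgeNear, hpre]
        exact .basic _ (Or.inl (Or.inl ⟨v, u, h, _,
          Metric.isOpen_ball.preimage continuous_subtype_val, rfl⟩))
  · obtain ⟨S, hS⟩ := exists_smallOff hs (r := r / 3) (by positivity)
    have hC := isComp_compVerts G S ω
    have hpre := preimage_endNhd hw he S ω hη0
    rw [max_eq_right (by linarith)] at hpre
    refine ⟨{z | 1 - η < massL G w (compVerts G S ω) z},
      isOpen_lt continuous_const (hC.finBoundary.continuous_massL hw), ?_, ?_, ?_⟩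
    · have := hC.smallSet hw hM hS (by positivity) hη1.le hηM
      rwa [mul_div_cancel₀ r three_ne_zero] at this
    · rw [Set.mem_ofPred_eq, ofMTop, he]
      linarith
    · rw [hpre]
      exact .basic _ (Or.inr ⟨S, ω, η, hη0, rfl⟩)

/-! ### The comparison map is an embedding -/

theorem continuous_ofMTop (hs : Summable w) : Continuous (ofMTop _ e) := by
  refine continuous_iff_continuousAt.2 fun p N hN => ?_
  obtain ⟨W, hW, hWN⟩ := UniformSpace.mem_nhds_iff.1 hN
  obtain ⟨r, hr, h⟩ := exists_small (isUniformInducing_toLTop _) (denseRange_toLTop _) hW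
  obtain ⟨O, hO, hsm, hp, hpre⟩ := exists_small_nhd hw he hs p hr
  exact mem_of_superset (hpre.mem_nhds hp) fun q hq => hWN (h O hO hsm _ hp _ hq)

theorem isInducing_ofMTop (hs : Summable w) : IsInducing (ofMTop _ e) := by
  refine ⟨le_antisymm (continuous_ofMTop hw he hs).le_induced (le_generateFrom ?_)⟩
  rintro A ((⟨u, v, h, U, hU, rfl⟩ | ⟨v, ε, h0, h1, rfl⟩) | ⟨S, ω, ε, h0, rfl⟩)
  · obtain ⟨U', hU', rfl⟩ := isOpen_induced_iff.1 hU
    refine isOpen_induced_iff.2 ⟨_, ?_, preimage_edgeSub hw he h U'⟩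
    exact (isOpen_lt continuous_const ((finBoundary_singleton G u).continuous_massL hw)).inter
      ((isOpen_lt continuous_const ((finBoundary_singleton G v).continuous_massL hw)).inter
        (hU'.preimage ((finBoundary_singleton G v).continuous_massL hw)))
  · exact isOpen_induced_iff.2 ⟨_, isOpen_lt continuous_const
      ((finBoundary_singleton G v).continuous_massL hw), preimage_openStar hw he v h0 h1⟩
  · exact isOpen_induced_iff.2 ⟨_, isOpen_lt continuous_const
      ((isComp_compVerts G S ω).finBoundary.continuous_massL hw), preimage_endNhd hw he S ω h0⟩

/-- Vertex weights separate points of `G` from one another and from ends, where they all vanish;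
component weights separate ends. -/
theorem injective_ofMTop : Function.Injective (ofMTop _ e) := by
  have hne : ∀ (x : Point G) (ω : VertexEnd G), toLTop _ x ≠ e ω := by
    intro x ω h
    obtain ⟨v, hv⟩ := exists_mass_singleton_pos x
    rw [← (finBoundary_singleton G v).massL_toLTop hw, h, massL_singleton_end hw he] at hv
    exact hv.false
  rintro (x | ω) (y | ω') h
  · refine congrArg _ (point_ext_of_mass fun v => ?_)
    rw [← (finBoundary_singleton G v).massL_toLTop hw, ← (finBoundary_singleton G v).massL_toLTop hw]
    exact congrArg _ h
  · exact (hne _ _ h).elim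
  · exact (hne _ _ h.symm).elim
  · refine congrArg _ (VertexEnd.ext_compVerts fun S => ?_)
    refine (massL_compVerts_pos_iff hw he S ω' ω).1 ?_
    have h' : e ω = e ω' := h
    rw [h', he]
    exact one_pos

/-! ### Surjectivity -/

omit he

/-- If the weight at `v` is 1, then `z` is `v`. If it is `c < 1`, a single nearby point of `G`
already selects the edge `vu`: the tent function of that edge is positive at `z`, which forces the
weights at `v` and `u` to sum to 1. So `z` is the point of the edge at parameter `1 - c`. -/
theorem exists_point_of_massL_pos (hs : Summable w) {z : LTop (meanLength G w)} {v : V}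
    (hz : 0 < massL G w {v} z) : ∃ x : Point G, toLTop _ x = z := by
  have hbv := finBoundary_singleton G v
  rcases (massL_le_one hw hbv z).lt_or_eq with h1 | h1
  · set c := massL G w {v} z with hc
    -- An error of `η` in the weight at `v` leaves both coordinates of the nearby point above `η`; a
    -- second error of `η`, in the tent function, then keeps it positive at `z`.
    obtain ⟨η, hη0, hη1, hη2⟩ : ∃ η : ℝ, 0 < η ∧ 2 * η < c ∧ 2 * η < 1 - c := by
      refine ⟨min c (1 - c) / 4, by have := lt_min hz (sub_pos.2 h1); positivity, ?_, ?_⟩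
      · have := min_le_left c (1 - c)
        linarith
      · have := min_le_right c (1 - c)
        linarith
    have hK := lipConst_nonneg hw {v}
    have hKδ : lipConst w {v} * (η / (lipConst w {v} + 1)) ≤ η := by
      rw [mul_div_assoc', div_le_iff₀ (by linarith)]
      nlinarith
    obtain ⟨x, hx⟩ := exists_near_toLTop z (δ := η / (lipConst w {v} + 1)) (by positivity)
    have hxv := (hx _ _ (isLip_mass_singleton hw v)).trans hKδ
    change |c - mass G {v} x| ≤ η at hxv
    rw [abs_le] at hxv
    rcases eq_vtx_or_edgePt_of_pos (by linarith : 0 < mass G {v} x) with rfl | ⟨u, h, t, rfl⟩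
    · rw [mass_vtx] at hxv
      simp at hxv
      linarith
    have hbu := finBoundary_singleton G u
    have key : ∀ t : unitInterval,
        mass G {v} (edgePt h t) = 1 - t ∧ mass G {u} (edgePt h t) = t :=
      fun t => by simp [mass_edgePt, h.ne, h.ne']
    have htent := (hx _ _ (isLip_tent hw h.ne)).trans hKδ
    have htz : 0 < extL _ (tent G v u) z := by
      rw [(key t).1] at hxv
      rw [tent, (key t).1, (key t).2, abs_le] at htent
      have : η < min (1 - (t : ℝ)) t := lt_min (by linarith) (by linarith)
      linarith
    have hsum : massL G w {v} z + massL G w {u} z = 1 := by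
      refine subset_of_toLTop (O := {z | 0 < extL _ (tent G v u) z})
        (F := {z | massL G w {v} z + massL G w {u} z = 1})
        (isOpen_lt continuous_const (continuous_extL (isLip_tent hw h.ne)))
        (isClosed_eq ((hbv.continuous_massL hw).add (hbu.continuous_massL hw)) continuous_const)
        (fun y hy => ?_) htz
      have hy' : 0 < tent G v u y := by
        rwa [Set.mem_ofPred_eq, extL_toLTop (isLip_tent hw h.ne)] at hy
      obtain ⟨_, s, -, -, rfl⟩ := eq_edgePt_of_pos h.ne (lt_min_iff.1 hy').1 (lt_min_iff.1 hy').2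
      rw [Set.mem_ofPred_eq, hbv.massL_toLTop hw, hbu.massL_toLTop hw, (key s).1, (key s).2]
      ring
    have huz : massL G w {u} z = 1 - c := by linarith
    refine ⟨edgePt h ⟨1 - c, by linarith, by linarith⟩, eq_of_forall_smallSet fun r hr => ?_⟩
    obtain ⟨M, η', hM, hη0', -, hηM⟩ := exists_bound hs hw (r := r / 2) (by positivity)
    refine ⟨edgeNear G w v u (1 - c) η', isOpen_edgeNear hw _ _ _ _, ?_, ?_, ?_⟩
    · rw [edgeNear, Set.mem_ofPred_eq, hbv.massL_toLTop hw, hbu.massL_toLTop hw, (key _).1,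
        (key _).2]
      exact ⟨by simpa using hz, by simpa using h1, Metric.mem_ball_self hη0'⟩
    · rw [edgeNear, Set.mem_ofPred_eq, huz]
      exact ⟨hz, by linarith, Metric.mem_ball_self hη0'⟩
    · have := smallSet_edgeNear (G := G) hw h.ne (1 - c) hM hηM
      rwa [mul_div_cancel₀ r two_ne_zero] at this
  · refine ⟨vtx G v, eq_of_forall_smallSet fun r hr => ?_⟩
    obtain ⟨M, η, hM, hη0, hη1, hηM⟩ := exists_bound hs hw (r := r / 2) (by positivity)
    refine ⟨{z | 1 - η < massL G w {v} z}, isOpen_lt continuous_const (hbv.continuous_massL hw),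
      ?_, ?_, ?_⟩
    · rw [Set.mem_ofPred_eq, hbv.massL_toLTop hw, mass_vtx]
      simpa using hη0
    · rw [Set.mem_ofPred_eq, h1]
      linarith
    · have := smallSet_vtx (G := G) hw v hM (by positivity) hη1.le hηM
      rwa [mul_div_cancel₀ r two_ne_zero] at this

/-- A nearby point `x` of `G` has weight at most 1/4 in `S`, hence at least 3/4 in some component of
`G - S`. At `z` that component still has weight at least 1/2, and so exactly 1 since `S` has none.
-/
theorem exists_isComp_massL_eq_one {z : LTop (meanLength G w)} (hz : ∀ v, massL G w {v} z = 0)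
    (S : Finset V) : ∃ C, IsComp G S C ∧ massL G w C z = 1 := by
  have hS : massL G w S z = 0 := by
    rw [massL_finset hw]
    exact Finset.sum_eq_zero fun v _ => hz v
  have hK := lipConst_nonneg hw S
  have hKδ : lipConst w S * (1 / 4 / (lipConst w S + 1)) ≤ 1 / 4 := by
    rw [mul_div_assoc', div_le_iff₀ (by linarith)]
    nlinarith
  obtain ⟨x, hx⟩ := exists_near_toLTop z (δ := 1 / 4 / (lipConst w S + 1)) (by positivity)
  have hxS := (hx _ _ (isLip_mass_finset hw S)).trans hKδ
  change |massL G w S z - mass G S x| ≤ _ at hxS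
  rw [hS, abs_le] at hxS
  obtain ⟨u, hu, hux⟩ := exists_mem_of_mass_pos (G := G) (A := (S : Set V)ᶜ) (x := x)
    (by linarith [mass_compl_add (S : Set V) x])
  have hC := isComp_setOf_joined G S u
  refine ⟨_, hC, ?_⟩
  have h1 := hC.mass_add_eq_one
    (mass_pos_of_mem (show u ∈ {v | Joined G S u v} from joined_self hu) hux)
  have h2 := (hx _ _ (isLip_mass hw fun a b h ha hb => hC.boundary h ha hb)).trans hKδ
  change |massL G w _ z - mass G _ x| ≤ _ at h2
  rw [abs_le] at h2
  have h3 := hC.massL_add_eq_one hw (z := z) (by linarith)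
  linarith

include he

theorem surjective_ofMTop [Countable V] (hs : Summable w) :
    Function.Surjective (ofMTop _ e) := by
  intro z
  by_cases hz : ∃ v, 0 < massL G w {v} z
  · obtain ⟨v, hv⟩ := hz
    obtain ⟨x, hx⟩ := exists_point_of_massL_pos hw hs hv
    exact ⟨.point x, hx⟩
  have hz0 : ∀ v, massL G w {v} z = 0 := fun v =>
    le_antisymm (not_lt.1 fun h => hz ⟨v, h⟩) (massL_nonneg hw (finBoundary_singleton G v) z)
  obtain ⟨f, hf⟩ := exists_injective_nat V
  -- These finite sets exhaust the vertices, so the components chosen below have empty intersection.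
  -- They are nested because any two, both of weight 1 at `z`, must meet.
  have hfin : ∀ n, {v | f v < n}.Finite := fun n => (Set.finite_Iio n).preimage hf.injOn
  choose C hC hCz using fun n => exists_isComp_massL_eq_one hw hz0 (hfin n).toFinset
  have hmeet : ∀ m n, ∃ u, u ∈ C m ∧ u ∈ C n := by
    intro m n
    by_contra hc
    have hd : Disjoint (C m) (C n) := Set.disjoint_left.2 fun u h1 h2 => hc ⟨u, h1, h2⟩
    have := massL_add_le_one hw (hC m).finBoundary (hC n).finBoundary hd z
    rw [hCz, hCz] at this
    linarith
  have hanti : Antitone C := by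
    intro m n hmn
    obtain ⟨u, hu, hu'⟩ := hmeet m n
    refine (hC m).subset (hC n) (fun v hv => ?_) hu hu'
    simp only [Set.Finite.mem_toFinset, Set.mem_ofPred_eq] at hv ⊢
    omega
  obtain ⟨R, hR⟩ := exists_ray_of_antitone hanti (fun n => (hmeet n n).imp fun _ h => h.1)
    (fun v => ⟨f v + 1, fun h => (hC _).notMem h (by simp)⟩)
    (fun n u hu v hv => (hC n).exists_walk hu hv)
  obtain ⟨ω, hω⟩ : ∃ ω, R.BelongsTo ω := ⟨_, R.belongsTo_mk⟩
  refine ⟨.vend ω, eq_of_forall_smallSet fun r hr => ?_⟩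
  obtain ⟨M, η, hM, hη0, hη1, hηM⟩ := exists_bound hs hw (r := r / 3) (by positivity)
  obtain ⟨S, hS⟩ := exists_smallOff hs (r := r / 3) (by positivity)
  -- A deleted set containing `S` makes `C n` small around `z`; the ray has a tail in `C n`, so the
  -- image of its end is in the same small set.
  have hSn : S ⊆ (hfin (S.sup f + 1)).toFinset := by
    intro v hv
    have := Finset.le_sup (f := f) hv
    simp only [Set.Finite.mem_toFinset, Set.mem_ofPred_eq]
    omega
  set n := S.sup f + 1
  have hCn : compVerts G (hfin n).toFinset ω = C n := by
    obtain ⟨i, hi⟩ := hR n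
    obtain ⟨j, hj⟩ := hω.exists_forall_mem (hfin n).toFinset
    exact (isComp_compVerts _ _ _).eq (hC n) (hj (max i j) (le_max_right _ _))
      (hi _ (le_max_left _ _))
  refine ⟨{z | 1 - η < massL G w (C n) z},
    isOpen_lt continuous_const ((hC n).finBoundary.continuous_massL hw), ?_, ?_, ?_⟩
  · change 1 - η < massL G w (C n) (e _)
    rw [← hCn, he]
    linarith
  · rw [Set.mem_ofPred_eq, hCz]
    linarith
  · have := (hC n).smallSet hw hM (hS.mono hSn) (by positivity) hη1.le hηM
    rwa [mul_div_cancel₀ r three_ne_zero] at this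

omit he

theorem lTopApproxMTop_meanLength [Countable V] (hs : Summable w) :
    LTopApproxMTop (meanLength G w) := by
  choose e he using exists_endPoint (G := G) hw hs
  let φ : MTop G ≃ LTop (meanLength G w) :=
    Equiv.ofBijective (ofMTop _ e) ⟨injective_ofMTop hw he, surjective_ofMTop hw he hs⟩
  refine ⟨(φ.toHomeomorphOfIsInducing (isInducing_ofMTop hw he hs)).symm, fun x => ?_⟩
  exact φ.symm_apply_apply (.point x)

end Completion

end GraphTop

theorem mainTheorem7 {V : Type*} [Countable V] (G : SimpleGraph V) :
    (∀ w : V → ℝ, (∀ v, 0 < w v) → Summable w →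
      GraphTop.LTopApproxMTop (GraphTop.meanLength G w)) ∧
    (∀ ℓ : G.edgeSet → ℝ, (∀ e, 0 < ℓ e) → Summable ℓ →
      GraphTop.LTopApproxMTop (GraphTop.meanLength G.lineGraph ℓ)) := by
  -- This makes the vertex set of the line graph countable, so the second claim is the first one
  -- applied to the line graph.
  have : Countable (Sym2 V) := Quot.mk_surjective.countable
  exact ⟨fun _ hw hs => GraphTop.lTopApproxMTop_meanLength hw hs,
    fun _ hℓ hs => GraphTop.lTopApproxMTop_meanLength hℓ hs⟩
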